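/- **Setting.** Let $M\ge 0$ be the number of modes and let $\mathcal H$ be the bosonic Fock space of $M$ modes, with orthonormal basis of number states $|n\rangle$, $n=(n_1,\dots,n_M)\in\mathbb Z_{\ge 0}^M$. Let $a_m|n\rangle=\sqrt{n_m}\,|n-\delta_m\rangle$ and $a_m^\dagger|n\rangle=\sqrt{n_m+1}\,|n+\delta_m\rangle$ (where $\delta_m$ is the $m$-th unit vector) be the annihilation and creation operators. For $\alpha\in\mathbb C^M$ let $$D(\alpha)=\exp\Big(\sum_{m=1}^M(\alpha_m a_m^\dagger-\overline{\alpha_m}\,a_m)\Big),\qquad \Pi=\exp\Big(-i\pi\sum_{m=1}^M a_m^\dagger a_m\Big),\qquad \Pi(\alpha)=D(\alpha)\,\Pi\,D(\alpha)^\dagger$$ be the displacement operators, the parity operator and the displaced parity operators, which are bounded operators on $\mathcal H$. For a matrix $A$, let $\|A\|_1$ be its trace norm, the sum of its singular values. **Proposition (Bochner's theorem and bounds of absolute volume of displaced parity).** Let $R=R^\dagger$ be a self-adjoint trace-class operator on $\mathcal H$, i.e. $\operatorname{tr}|R|<\infty$, and let $\Xi=\{\xi_n\}_{n=1}^N$ be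 any finite family of points of $\mathbb C^M$. Let $C(R;\Xi)\in\mathbb C^{N\times N}$ be the matrix with entries $$[C(R;\Xi)]_{n,n'}=\frac1N\operatorname{tr}\big[R\,D(\xi_n-\xi_{n'})\big].$$ Then $$\|C(R;\Xi)\|_1\;\le\;\Big(\frac{2}{\pi}\Big)^{M}\int_{\mathbb C^M}\big|\operatorname{tr}[R\,\Pi(\alpha)]\big|\,d^{2M}\alpha ,$$ where $d^{2M}\alpha=\prod_m d\operatorname{Re}\alpha_m\,d\operatorname{Im}\alpha_m$ is Lebesgue measure on $\mathbb C^M\cong\mathbb R^{2M}$ and the right-hand side is $+\infty$ if the integral diverges. -/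

import Mathlib

open scoped ComplexConjugate InnerProductSpace

namespace BosonicModes

noncomputable section

/-! ## Trace-class operators and the trace -/

section TraceClass

/-- The absolute value `|T| = (T† T)^{1/2}` of a bounded operator on a complex Hilbert space. -/
def absOp {H : Type*} [NormedAddCommGroup H] [InnerProductSpace ℂ H] [CompleteSpace H]
    (T : H →L[ℂ] H) : H →L[ℂ] H :=
  CFC.abs T

/-- `T` is trace class: `‖T‖₁ = tr |T| = ∑ᵢ ⟨bᵢ, |T| bᵢ⟩ < ∞`. As `|T|` is positive, this does not
depend on the orthonormal basis `b`. -/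
def IsTraceClass {ι H : Type*} [NormedAddCommGroup H] [InnerProductSpace ℂ H] [CompleteSpace H]
    (b : HilbertBasis ι ℂ H) (T : H →L[ℂ] H) : Prop :=
  Summable fun i => (⟪b i, absOp T (b i)⟫_ℂ).re

/-- The trace `tr T = ∑ᵢ ⟨bᵢ, T bᵢ⟩`. For trace-class `T` the series converges absolutely and its
sum does not depend on the orthonormal basis `b`. -/
def trace {ι H : Type*} [NormedAddCommGroup H] [InnerProductSpace ℂ H]
    (b : HilbertBasis ι ℂ H) (T : H →L[ℂ] H) : ℂ :=
  ∑' i, ⟪b i, T (b i)⟫_ℂ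

/-- The trace norm of a complex square matrix: the sum of its singular values. -/
def matrixTraceNorm {N : ℕ} (A : Matrix (Fin N) (Fin N) ℂ) : ℝ :=
  ∑ i : Fin N, (Matrix.toEuclideanLin A).singularValues i

end TraceClass

/-! ## Fock space of `M` modes, ladder operators -/

/-- The Hilbert space of `M` modes, `ℓ²` over the occupation numbers `n = (n₁, …, n_M)`. -/
abbrev FockSpace (M : ℕ) : Type := lp (fun _ : Fin M → ℕ => ℂ) 2

/-- The orthonormal basis of number states `|n⟩`. -/
def numberBasis (M : ℕ) : HilbertBasis (Fin M → ℕ) ℂ (FockSpace M) :=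
  HilbertBasis.ofRepr (LinearIsometryEquiv.refl ℂ (FockSpace M))

/-- Finite linear combinations of number states: a common invariant dense domain of the
(unbounded) ladder operators. -/
abbrev FiniteVec (M : ℕ) : Type := (Fin M → ℕ) →₀ ℂ

/-- The inclusion of the finite vectors into Fock space. -/
def embed (M : ℕ) : FiniteVec M →ₗ[ℂ] FockSpace M :=
  Finsupp.linearCombination ℂ (numberBasis M)

/-- The creation operator of mode `m`: `a_m† |n⟩ = √(n_m + 1) |n + δ_m⟩`. -/
def creation {M : ℕ} (m : Fin M) : FiniteVec M →ₗ[ℂ] FiniteVec M :=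
  Finsupp.linearCombination ℂ fun n =>
    Finsupp.single (Function.update n m (n m + 1)) ((Real.sqrt ((n m : ℝ) + 1) : ℝ) : ℂ)

/-- The annihilation operator of mode `m`: `a_m |n⟩ = √(n_m) |n - δ_m⟩` (which is `0` if
`n_m = 0`). -/
def annihilation {M : ℕ} (m : Fin M) : FiniteVec M →ₗ[ℂ] FiniteVec M :=
  Finsupp.linearCombination ℂ fun n =>
    Finsupp.single (Function.update n m (n m - 1)) ((Real.sqrt (n m : ℝ) : ℝ) : ℂ)

/-- `α ∧ a = ∑_m (α_m a_m† - α_m^* a_m)`. -/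
def displacementGenerator {M : ℕ} (α : Fin M → ℂ) : FiniteVec M →ₗ[ℂ] FiniteVec M :=
  ∑ m, (α m • creation m - conj (α m) • annihilation m)

/-- `-iπ ∑_m a_m† a_m`. -/
def parityGenerator (M : ℕ) : FiniteVec M →ₗ[ℂ] FiniteVec M :=
  (-(Complex.I * (Real.pi : ℂ))) • ∑ m : Fin M, creation m ∘ₗ annihilation m

/-! ## Exponentials -/

/-- `T` is the exponential `e^A` of the operator `A` defined on finite vectors: `T` is bounded and
`T v = ∑_k A^k v / k!` (norm-convergent) for every finite vector `v`. -/
def IsExp {M : ℕ} (A : FiniteVec M →ₗ[ℂ] FiniteVec M) (T : FockSpace M →L[ℂ] FockSpace M) :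
    Prop :=
  ∀ v : FiniteVec M,
    HasSum (fun k : ℕ => ((Nat.factorial k : ℂ)⁻¹) • embed M ((A ^ k) v)) (T (embed M v))

theorem numberBasis_apply {M : ℕ} (n : Fin M → ℕ) :
    numberBasis M n = lp.single 2 n (1 : ℂ) := by
  have := (numberBasis M).repr_symm_single n
  rw [← this]; rfl

theorem embed_single {M : ℕ} (n : Fin M → ℕ) (c : ℂ) :
    embed M (Finsupp.single n c) = c • numberBasis M n := by
  simp [embed]

theorem norm_embed_single {M : ℕ} (n : Fin M → ℕ) (c : ℂ) :
    ‖embed M (Finsupp.single n c)‖ = ‖c‖ := by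
  rw [embed_single, norm_smul, (numberBasis M).orthonormal.1 n, mul_one]

theorem denseRange_embed (M : ℕ) : DenseRange (embed M) := by
  have h := (numberBasis M).dense_span
  rw [← Finsupp.range_linearCombination] at h
  have h2 : Dense ((LinearMap.range (embed M) : Submodule ℂ (FockSpace M)) : Set (FockSpace M)) :=
    Submodule.dense_iff_topologicalClosure_eq_top.2 h
  rw [LinearMap.coe_range] at h2
  exact h2

/-- A skew-symmetric operator on finite vectors whose exponential series converges absolutely
there has a unique bounded exponential. -/
theorem existsUnique_isExp {M : ℕ} (A : FiniteVec M →ₗ[ℂ] FiniteVec M)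
    (hskew : ∀ u v, ⟪embed M (A u), embed M v⟫_ℂ = -⟪embed M u, embed M (A v)⟫_ℂ)
    (hsum : ∀ n : Fin M → ℕ,
      Summable fun k : ℕ => ((Nat.factorial k : ℝ)⁻¹) * ‖embed M ((A ^ k) (Finsupp.single n 1))‖) :
    ∃! T : FockSpace M →L[ℂ] FockSpace M, IsExp A T := by
  have hsum' : ∀ v : FiniteVec M,
      Summable fun k : ℕ => ‖((Nat.factorial k : ℂ)⁻¹) • embed M ((A ^ k) v)‖ := by
    intro v
    induction v using Finsupp.induction_linear with
    | zero => simp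
    | add u v hu hv =>
      refine Summable.of_nonneg_of_le (fun _ => norm_nonneg _) (fun k => ?_) (hu.add hv)
      rw [map_add, map_add, smul_add]
      exact norm_add_le _ _
    | single n c =>
      refine ((hsum n).mul_left ‖c‖).congr fun k => ?_
      have : (Finsupp.single n c : FiniteVec M) = c • Finsupp.single n 1 := by simp
      rw [this, map_smul, map_smul, norm_smul, norm_smul]
      simp
      ring
  let S : FiniteVec M →ₗ[ℂ] FockSpace M :=
    { toFun := fun v => ∑' k : ℕ, ((Nat.factorial k : ℂ)⁻¹) • embed M ((A ^ k) v)
      map_add' := by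
        intro u v
        rw [← (hsum' u).of_norm.tsum_add (hsum' v).of_norm]
        simp [smul_add]
      map_smul' := by
        intro c v
        rw [RingHom.id_apply, ← (hsum' v).of_norm.tsum_const_smul]
        exact tsum_congr fun k => by rw [map_smul, map_smul, smul_comm] }
  have hS : ∀ v, HasSum (fun k : ℕ => ((Nat.factorial k : ℂ)⁻¹) • embed M ((A ^ k) v)) (S v) :=
    fun v => (hsum' v).of_norm.hasSum
  have hskewk : ∀ (k : ℕ) (u v : FiniteVec M),
      ⟪embed M ((A ^ k) u), embed M v⟫_ℂ = (-1) ^ k * ⟪embed M u, embed M ((A ^ k) v)⟫_ℂ := by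
    intro k
    induction k with
    | zero => intro u v; simp
    | succ k ih =>
      intro u v
      rw [pow_succ', Module.End.mul_apply, hskew, ih, ← Module.End.mul_apply, ← pow_succ, pow_succ',
        pow_succ]
      ring
  have hiso : ∀ v, ⟪S v, S v⟫_ℂ = ⟪embed M v, embed M v⟫_ℂ := by
    intro v
    set f : ℕ → FockSpace M := fun k => ((Nat.factorial k : ℂ)⁻¹) • embed M ((A ^ k) v) with hf
    have hF : Summable fun p : ℕ × ℕ => ⟪f p.1, f p.2⟫_ℂ := by
      refine Summable.of_norm_bounded
        ((hsum' v).mul_of_nonneg (hsum' v) (fun _ => norm_nonneg _) (fun _ => norm_nonneg _)) ?_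
      exact fun p => norm_inner_le_norm _ _
    have h1 : ∑' p : ℕ × ℕ, ⟪f p.1, f p.2⟫_ℂ = ⟪S v, S v⟫_ℂ := by
      rw [hF.tsum_prod]
      have h2 : ∀ i, ∑' j, ⟪f i, f j⟫_ℂ = ⟪f i, S v⟫_ℂ := fun i =>
        ((hS v).mapL (innerSL ℂ (f i))).tsum_eq
      simp_rw [h2]
      have h3 := ((hS v).mapL (innerSL ℂ (S v)))
      have h4 := (Complex.hasSum_conj'.2 h3).tsum_eq
      simpa [hf, inner_conj_symm, mul_comm] using h4
    have hF' := Finset.HasAntidiagonal.sigmaAntidiagonalEquivProd.summable_iff.2 hF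
    rw [← h1, ← Finset.HasAntidiagonal.sigmaAntidiagonalEquivProd.tsum_eq
      (fun p : ℕ × ℕ => ⟪f p.1, f p.2⟫_ℂ)]
    refine (Summable.tsum_sigma' (fun n => (hasSum_fintype _).summable) hF').trans ?_
    have h5 : ∀ n : ℕ, (∑' p : Finset.HasAntidiagonal.antidiagonal n,
        ⟪f (p : ℕ × ℕ).1, f (p : ℕ × ℕ).2⟫_ℂ) =
        if n = 0 then ⟪embed M v, embed M v⟫_ℂ else 0 := by
      intro n
      rw [tsum_fintype, Finset.univ_eq_attach,
        Finset.sum_attach (Finset.HasAntidiagonal.antidiagonal n) fun p => ⟪f p.1, f p.2⟫_ℂ]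
      have h6 : ∀ p ∈ Finset.HasAntidiagonal.antidiagonal n, ⟪f p.1, f p.2⟫_ℂ =
          (n.choose p.1 • ((-1 : ℂ) ^ p.1 * 1 ^ p.2)) *
            ((Nat.factorial n : ℂ)⁻¹ * ⟪embed M v, embed M ((A ^ n) v)⟫_ℂ) := by
        rintro ⟨i, j⟩ hp
        obtain rfl : i + j = n := by simpa using hp
        simp only [hf, inner_smul_left, inner_smul_right, hskewk, map_inv₀, Complex.conj_natCast,
          ← Module.End.mul_apply, ← pow_add, one_pow, mul_one, nsmul_eq_mul]
        have h7 : ((i + j).choose i : ℂ) * (i.factorial : ℂ) * (j.factorial : ℂ)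
            = ((i + j).factorial : ℂ) := by
          have h := Nat.add_choose_mul_factorial_mul_factorial j i
          rw [add_comm j i] at h
          rw [mul_right_comm]
          exact_mod_cast h
        have hi : (i.factorial : ℂ) ≠ 0 := by exact_mod_cast i.factorial_ne_zero
        have hj : (j.factorial : ℂ) ≠ 0 := by exact_mod_cast j.factorial_ne_zero
        have hij : ((i + j).factorial : ℂ) ≠ 0 := by exact_mod_cast (i + j).factorial_ne_zero
        have h8 : ((i + j).choose i : ℂ) * ((i + j).factorial : ℂ)⁻¹
            = (i.factorial : ℂ)⁻¹ * (j.factorial : ℂ)⁻¹ := by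
          rw [← div_eq_mul_inv, div_eq_iff hij, ← h7]
          field_simp
        linear_combination (-(-1 : ℂ) ^ i * ⟪embed M v, embed M ((A ^ (i + j)) v)⟫_ℂ) * h8
      rw [Finset.sum_congr rfl h6, ← Finset.sum_mul, ← (Commute.all (-1 : ℂ) 1).add_pow']
      rcases Nat.eq_zero_or_pos n with rfl | hn
      · simp
      · simp [hn.ne']
    refine (tsum_congr h5).trans ?_
    rw [tsum_ite_eq]
  have hnorm : ∀ v, ‖S v‖ ≤ 1 * ‖embed M v‖ := by
    intro v
    have h := hiso v
    rw [inner_self_eq_norm_sq_to_K, inner_self_eq_norm_sq_to_K] at h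
    have h' : ‖S v‖ ^ 2 = ‖embed M v‖ ^ 2 := by exact_mod_cast h
    rw [one_mul]
    exact (sq_le_sq₀ (norm_nonneg _) (norm_nonneg _)).1 h'.le
  refine ⟨S.extendOfNorm (embed M), fun v => ?_, fun T hT => ?_⟩
  · rw [LinearMap.extendOfNorm_eq (denseRange_embed M) ⟨1, hnorm⟩]
    exact hS v
  · have hfun : (T : FockSpace M → FockSpace M) = S.extendOfNorm (embed M) := by
      refine (denseRange_embed M).equalizer T.continuous
        (S.extendOfNorm (embed M)).continuous ?_
      funext v
      simp only [Function.comp_apply]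
      rw [LinearMap.extendOfNorm_eq (denseRange_embed M) ⟨1, hnorm⟩]
      exact (hT v).unique (hS v)
    exact DFunLike.coe_injective hfun

theorem inner_creation {M : ℕ} (m : Fin M) (u v : FiniteVec M) :
    ⟪embed M (creation m u), embed M v⟫_ℂ = ⟪embed M u, embed M (annihilation m v)⟫_ℂ := by
  induction u using Finsupp.induction_linear with
  | zero => simp
  | add u u' hu hu' => simp only [map_add, inner_add_left, hu, hu']
  | single n c =>
    induction v using Finsupp.induction_linear with
    | zero => simp
    | add v v' hv hv' => simp only [map_add, inner_add_right, hv, hv']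
    | single n' c' =>
      have ho := orthonormal_iff_ite.1 (numberBasis M).orthonormal
      simp only [creation, annihilation, Finsupp.linearCombination_single, Finsupp.smul_single,
        embed_single, inner_smul_left, inner_smul_right, ho, smul_eq_mul, map_mul,
        Complex.conj_ofReal]
      by_cases h : Function.update n m (n m + 1) = n'
      · subst h
        simp
        ring
      · by_cases h0 : n' m = 0
        · simp [h, h0]
        · have : n ≠ Function.update n' m (n' m - 1) := by
            rintro rfl
            apply h
            simp [Nat.sub_add_cancel (Nat.one_le_iff_ne_zero.2 h0)]
          simp [h, this]

theorem inner_annihilation {M : ℕ} (m : Fin M) (u v : FiniteVec M) :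
    ⟪embed M (annihilation m u), embed M v⟫_ℂ = ⟪embed M u, embed M (creation m v)⟫_ℂ := by
  rw [← inner_conj_symm, ← inner_creation, inner_conj_symm]

theorem norm_displacementGenerator_pow_le {M : ℕ} (α : Fin M → ℂ) (k : ℕ) :
    ∀ (s : ℕ) (n : Fin M → ℕ), (∀ m, n m ≤ s) →
      ‖embed M ((displacementGenerator α ^ k) (Finsupp.single n 1))‖ ≤
        ∏ j ∈ Finset.range k, ((∑ m, 2 * ‖α m‖) * Real.sqrt ((s : ℝ) + 1 + j)) := by
  induction k with
  | zero => intro s n _; simp [norm_embed_single]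
  | succ k ih =>
    intro s n hn
    have e : (displacementGenerator α ^ (k + 1)) (Finsupp.single n 1) =
        ∑ m, ((α m * (Real.sqrt ((n m : ℝ) + 1) : ℝ)) • (displacementGenerator α ^ k)
            (Finsupp.single (Function.update n m (n m + 1)) 1)
          - (conj (α m) * (Real.sqrt (n m : ℝ) : ℝ)) • (displacementGenerator α ^ k)
            (Finsupp.single (Function.update n m (n m - 1)) 1)) := by
      have e1 : displacementGenerator α (Finsupp.single n 1) =
          ∑ m, ((α m * (Real.sqrt ((n m : ℝ) + 1) : ℝ)) •
              Finsupp.single (Function.update n m (n m + 1)) (1 : ℂ)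
            - (conj (α m) * (Real.sqrt (n m : ℝ) : ℝ)) •
              Finsupp.single (Function.update n m (n m - 1)) (1 : ℂ)) := by
        simp only [displacementGenerator, LinearMap.sum_apply, LinearMap.sub_apply,
          LinearMap.smul_apply, creation, annihilation, Finsupp.linearCombination_single, one_smul,
          Finsupp.smul_single, smul_eq_mul, mul_one]
      rw [pow_succ, Module.End.mul_apply, e1]
      simp only [map_sum, map_sub, map_smul]
    set P : ℝ := ∏ j ∈ Finset.range k,
      ((∑ m, 2 * ‖α m‖) * Real.sqrt (((s + 1 : ℕ) : ℝ) + 1 + j)) with hP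
    have hP0 : 0 ≤ P := Finset.prod_nonneg fun j _ => by positivity
    have hb : ∀ m, ‖embed M ((α m * (Real.sqrt ((n m : ℝ) + 1) : ℝ)) •
            (displacementGenerator α ^ k) (Finsupp.single (Function.update n m (n m + 1)) 1)
          - (conj (α m) * (Real.sqrt (n m : ℝ) : ℝ)) • (displacementGenerator α ^ k)
            (Finsupp.single (Function.update n m (n m - 1)) 1))‖ ≤
        2 * ‖α m‖ * (Real.sqrt ((s : ℝ) + 1) * P) := by
      intro m
      have hm : (n m : ℝ) ≤ s := by exact_mod_cast hn m
      have u1 := ih (s + 1) (Function.update n m (n m + 1)) (by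
        intro i
        by_cases hi : i = m
        · subst hi; simpa using hn i
        · simpa [hi] using (hn i).trans (Nat.le_succ s))
      have u2 := ih (s + 1) (Function.update n m (n m - 1)) (by
        intro i
        by_cases hi : i = m
        · subst hi; simpa using (hn i).trans (by omega)
        · simpa [hi] using (hn i).trans (Nat.le_succ s))
      have s1 : Real.sqrt ((n m : ℝ) + 1) ≤ Real.sqrt ((s : ℝ) + 1) :=
        Real.sqrt_le_sqrt (by linarith)
      have s2 : Real.sqrt (n m : ℝ) ≤ Real.sqrt ((s : ℝ) + 1) :=
        Real.sqrt_le_sqrt (by linarith)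
      rw [map_sub, map_smul, map_smul]
      refine (norm_sub_le _ _).trans ?_
      rw [norm_smul, norm_smul, norm_mul, norm_mul, RCLike.norm_conj, Complex.norm_real,
        Complex.norm_real, Real.norm_of_nonneg (Real.sqrt_nonneg _),
        Real.norm_of_nonneg (Real.sqrt_nonneg _), mul_assoc, mul_assoc, mul_assoc, two_mul]
      rw [← mul_add, ← mul_add]
      refine mul_le_mul_of_nonneg_left ?_ (norm_nonneg (α m))
      exact add_le_add (mul_le_mul s1 u1 (norm_nonneg _) (Real.sqrt_nonneg _))
        (mul_le_mul s2 u2 (norm_nonneg _) (Real.sqrt_nonneg _))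
    rw [e, map_sum]
    refine (norm_sum_le _ _).trans ((Finset.sum_le_sum fun m _ => hb m).trans (le_of_eq ?_))
    rw [← Finset.sum_mul, Finset.prod_range_succ', hP]
    have : ∀ j : ℕ, (s : ℝ) + 1 + ((j + 1 : ℕ) : ℝ) = ((s + 1 : ℕ) : ℝ) + 1 + j := by
      intro j; push_cast; ring
    simp_rw [this]
    simp
    ring

theorem existsUnique_displacement {M : ℕ} (α : Fin M → ℂ) :
    ∃! T : FockSpace M →L[ℂ] FockSpace M, IsExp (displacementGenerator α) T := by
  refine existsUnique_isExp _ (fun u v => ?_) (fun n => ?_)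
  · simp only [displacementGenerator, LinearMap.sum_apply, LinearMap.sub_apply,
      LinearMap.smul_apply, map_sum, map_sub, map_smul, sum_inner, inner_sum, inner_sub_left,
      inner_sub_right, inner_smul_left, inner_smul_right, inner_creation, inner_annihilation,
      Complex.conj_conj, ← Finset.sum_neg_distrib, neg_sub]
  · set B : ℝ := ∑ m, 2 * ‖α m‖ with hB
    have hB0 : 0 ≤ B := by positivity
    set s : ℕ := ∑ m, n m with hs
    have hle : ∀ m, n m ≤ s := fun m =>
      Finset.single_le_sum (f := n) (fun i _ => Nat.zero_le (n i)) (Finset.mem_univ m)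
    set g : ℕ → ℝ := fun k => ((Nat.factorial k : ℝ)⁻¹) *
      ∏ j ∈ Finset.range k, ((B + 1) * Real.sqrt ((s : ℝ) + 1 + j)) with hg
    have hgpos : ∀ k, 0 < g k := fun k => by
      refine mul_pos (by positivity) (Finset.prod_pos fun j _ => by positivity)
    have hgs : Summable g := by
      refine summable_of_ratio_test_tendsto_lt_one (l := 0) one_pos
        (Filter.Eventually.of_forall fun k => (hgpos k).ne') ?_
      have hr : ∀ k : ℕ, ‖g (k + 1)‖ / ‖g k‖ =
          (B + 1) * (Real.sqrt ((s : ℝ) + 1 + k) / ((k : ℝ) + 1)) := by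
        intro k
        rw [Real.norm_of_nonneg (hgpos _).le, Real.norm_of_nonneg (hgpos _).le,
          div_eq_iff (hgpos k).ne']
        simp only [hg, Finset.prod_range_succ, Nat.factorial_succ]
        push_cast
        have : (k.factorial : ℝ) ≠ 0 := by positivity
        field_simp
      simp_rw [hr]
      rw [← mul_zero (B + 1)]
      refine Filter.Tendsto.const_mul _ ?_
      have hlim : Filter.Tendsto (fun k : ℕ => ((s : ℝ) + 1) * (1 / Real.sqrt ((k : ℝ) + 1)))
          Filter.atTop (nhds 0) := by
        rw [← mul_zero ((s : ℝ) + 1)]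
        refine Filter.Tendsto.const_mul _ ?_
        have h1 : Filter.Tendsto (fun k : ℕ => 1 / ((k : ℝ) + 1)) Filter.atTop (nhds 0) :=
          tendsto_one_div_add_atTop_nhds_zero_nat
        have h2 := (Real.continuous_sqrt.tendsto 0).comp h1
        simpa [Function.comp_def] using h2
      refine squeeze_zero (fun k => by positivity) (fun k => ?_) hlim
      have hk : (0 : ℝ) < (k : ℝ) + 1 := by positivity
      have hsq : Real.sqrt ((k : ℝ) + 1) * Real.sqrt ((k : ℝ) + 1) = (k : ℝ) + 1 :=
        Real.mul_self_sqrt hk.le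
      have hsp : 0 < Real.sqrt ((k : ℝ) + 1) := Real.sqrt_pos.2 hk
      have h3 : Real.sqrt ((s : ℝ) + 1 + k) ≤ ((s : ℝ) + 1) * Real.sqrt ((k : ℝ) + 1) := by
        rw [Real.sqrt_le_left (by positivity), mul_pow, Real.sq_sqrt hk.le]
        have : (0 : ℝ) ≤ s := by positivity
        have : (0 : ℝ) ≤ k := by positivity
        nlinarith [mul_nonneg ‹(0 : ℝ) ≤ s› ‹(0 : ℝ) ≤ k›, mul_nonneg (mul_nonneg ‹(0 : ℝ) ≤ s› ‹(0 : ℝ) ≤ s›) ‹(0 : ℝ) ≤ k›]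
      rw [div_le_iff₀ hk]
      calc _ ≤ ((s : ℝ) + 1) * Real.sqrt ((k : ℝ) + 1) := h3
        _ = _ := by
          nth_rewrite 3 [← hsq]
          field_simp
    refine Summable.of_nonneg_of_le (fun k => by positivity) (fun k => ?_) hgs
    refine mul_le_mul_of_nonneg_left
      ((norm_displacementGenerator_pow_le α k s n hle).trans ?_) (by positivity)
    refine Finset.prod_le_prod (fun j _ => by positivity) fun j _ => ?_
    exact mul_le_mul_of_nonneg_right (by linarith) (Real.sqrt_nonneg _)

theorem parityGenerator_single {M : ℕ} (n : Fin M → ℕ) :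
    parityGenerator M (Finsupp.single n 1) =
      (-(Complex.I * (Real.pi : ℂ)) * ((∑ m, n m : ℕ) : ℂ)) • Finsupp.single n (1 : ℂ) := by
  have h : ∀ m : Fin M, creation m (annihilation m (Finsupp.single n 1)) =
      ((n m : ℕ) : ℂ) • Finsupp.single n (1 : ℂ) := by
    intro m
    simp only [creation, annihilation, Finsupp.linearCombination_single, one_smul,
      Finsupp.smul_single, smul_eq_mul, mul_one]
    by_cases h0 : n m = 0
    · simp [h0]
    · have h1 : n m - 1 + 1 = n m := Nat.sub_add_cancel (Nat.one_le_iff_ne_zero.2 h0)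
      have h2 : (((n m - 1 : ℕ) : ℝ) + 1) = (n m : ℝ) := by exact_mod_cast h1
      simp only [Function.update_self, Function.update_idem, h1, h2, Function.update_eq_self]
      rw [← Complex.ofReal_mul, Real.mul_self_sqrt (by positivity)]
      simp
  simp only [parityGenerator, LinearMap.smul_apply, LinearMap.sum_apply, LinearMap.comp_apply, h]
  rw [← Finset.sum_smul, smul_smul]
  push_cast
  rfl

theorem existsUnique_parity (M : ℕ) :
    ∃! T : FockSpace M →L[ℂ] FockSpace M, IsExp (parityGenerator M) T := by
  refine existsUnique_isExp _ (fun u v => ?_) (fun n => ?_)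
  · simp only [parityGenerator, LinearMap.sum_apply, LinearMap.smul_apply, LinearMap.comp_apply,
      map_sum, map_smul, sum_inner, inner_sum, inner_smul_left, inner_smul_right, inner_creation,
      inner_annihilation, map_neg, map_mul, Complex.conj_I, Complex.conj_ofReal]
    ring
  · set c : ℂ := -(Complex.I * (Real.pi : ℂ)) * ((∑ m, n m : ℕ) : ℂ) with hc
    have hk : ∀ k : ℕ, (parityGenerator M ^ k) (Finsupp.single n 1) =
        c ^ k • Finsupp.single n (1 : ℂ) := by
      intro k
      induction k with
      | zero => simp
      | succ k ih =>
        rw [pow_succ', Module.End.mul_apply, ih, map_smul, parityGenerator_single, smul_smul,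
          pow_succ]
    refine (Real.summable_pow_div_factorial ‖c‖).congr fun k => ?_
    rw [hk, map_smul, norm_smul, norm_embed_single, norm_pow, norm_one]
    ring

/-! ## Displacement, parity and displaced parity operators -/

/-- The displacement operator `D(α) = exp(∑_m (α_m a_m† - α_m^* a_m))`. -/
def displacement {M : ℕ} (α : Fin M → ℂ) : FockSpace M →L[ℂ] FockSpace M :=
  (existsUnique_displacement α).choose

/-- The parity operator `Π = exp(-iπ ∑_m a_m† a_m)`. -/
def parity (M : ℕ) : FockSpace M →L[ℂ] FockSpace M :=
  (existsUnique_parity M).choose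

theorem isExp_displacement {M : ℕ} (α : Fin M → ℂ) :
    IsExp (displacementGenerator α) (displacement α) :=
  (existsUnique_displacement α).choose_spec.1

theorem isExp_parity (M : ℕ) : IsExp (parityGenerator M) (parity M) :=
  (existsUnique_parity M).choose_spec.1

/-- The displaced parity operator `Π(α) = D(α) Π D(α)†`. -/
def displacedParity {M : ℕ} (α : Fin M → ℂ) : FockSpace M →L[ℂ] FockSpace M :=
  displacement α ∘L parity M ∘L ContinuousLinearMap.adjoint (displacement α)

/-- The matrix `C(R; Ξ)` with entries `(1/N) tr[R D(ξ_n - ξ_{n'})]`. -/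
def characteristicMatrix {M N : ℕ} (R : FockSpace M →L[ℂ] FockSpace M) (ξ : Fin N → Fin M → ℂ) :
    Matrix (Fin N) (Fin N) ℂ :=
  Matrix.of fun n n' => (1 / (N : ℂ)) * trace (numberBasis M) (R ∘L displacement (ξ n - ξ n'))

end

end BosonicModes

/-! Write `w α` for tr[R Π(α)]. The theorem is the easy half of Bochner's theorem once the
characteristic function is known to be the symplectic Fourier transform of `w`: tr[R D(ξ)] = (2/π)^M
∫ e^{ξ·ᾱ - α·ξ̄} w(α) dα when `w` is integrable (`trace_displacement_eq_integral`). The phase is a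
character in ξ, so the matrix C(R; Ξ) equals ∫ (2/π)^M w(α) v(α) v(α)† dα with v(α)_n = N^{-1/2}
e^{ξ_n·ᾱ - α·ξ̄_n}. Each v(α) has norm at most one, so each v v† has trace norm at most one, and the
triangle inequality for integrals gives the bound (`matrixTraceNorm_le`). If `w` is not integrable,
the right-hand side is infinite.

The Fourier formula rests on the operator identity (2/π)^M ∫ e^{-s²|α|²} Π(α) dα = π^{-M} ∫
e^{-|u|²} D(su) du, read weakly (`gaussian_displacedParity`). The Gaussian makes both sides
absolutely convergent. Between coherent states both are explicit Gaussian integrals, and coherent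
states are total. Sandwiching the identity between two copies of D(ξ/2) turns D(su) into D(ξ + su)
and multiplies Π(α) by the phase. A trace-class R is then inserted through a nuclear representation
tr[R T] = ∑ ⟨x_i, T y_i⟩ valid for all T at once (`exists_hasSum_trace`), and dominated convergence
as s → 0 removes the regularisation.

All matrix elements come from the Weyl relation and the vacuum expectation of D(β). Both follow from
Baker–Campbell–Hausdorff with a scalar commutator, proved as an identity between power series
coefficients, so that no unbounded operator has to be exponentiated outside the finite vectors. -/

namespace BosonicModes

/-! ## Exponentials of operators with a scalar commutator -/

section Algebra

open Finset

variable {𝒜 : Type*} [Ring 𝒜] [Algebra ℂ 𝒜]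

/-- The Leibniz rule for the coefficients of a Cauchy product. -/
theorem succ_smul_sum_antidiagonal_mul (x y : ℕ → 𝒜) (n : ℕ) :
    ((n : ℂ) + 1) • ∑ p ∈ antidiagonal (n + 1), x p.1 * y p.2 =
      (∑ p ∈ antidiagonal n, (((p.1 : ℂ) + 1) • x (p.1 + 1)) * y p.2) +
        ∑ p ∈ antidiagonal n, x p.1 * (((p.2 : ℂ) + 1) • y (p.2 + 1)) := by
  have h : ((n : ℂ) + 1) • ∑ p ∈ antidiagonal (n + 1), x p.1 * y p.2 =
      (∑ p ∈ antidiagonal (n + 1), ((p.1 : ℂ) • x p.1) * y p.2) +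
        ∑ p ∈ antidiagonal (n + 1), x p.1 * ((p.2 : ℂ) • y p.2) := by
    rw [smul_sum, ← sum_add_distrib]
    refine sum_congr rfl fun p hp => ?_
    have : (n : ℂ) + 1 = p.1 + p.2 := by
      have := mem_antidiagonal.1 hp
      exact_mod_cast this.symm
    rw [this, add_smul, smul_mul_assoc, mul_smul_comm]
  rw [h, Nat.sum_antidiagonal_succ, Nat.sum_antidiagonal_succ']
  simp

/-- The coefficients of `exp (c t² / 2)` as a power series in `t`. -/
noncomputable def gaussCoeff (c : ℂ) (j : ℕ) : ℂ :=
  if Even j then ((j / 2).factorial : ℂ)⁻¹ * (c / 2) ^ (j / 2) else 0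

theorem gaussCoeff_two_mul (c : ℂ) (l : ℕ) :
    gaussCoeff c (2 * l) = (l.factorial : ℂ)⁻¹ * (c / 2) ^ l := by
  simp [gaussCoeff]

/-- Coefficientwise form of the differential equation g' = c t g satisfied by g = exp(c t²/2). -/
theorem succ_mul_gaussCoeff (c : ℂ) (j : ℕ) :
    ((j : ℂ) + 1 + 1) * gaussCoeff c (j + 1 + 1) = c * gaussCoeff c j := by
  rcases Nat.even_or_odd' j with ⟨l, rfl | rfl⟩
  · rw [show 2 * l + 1 + 1 = 2 * (l + 1) by ring, gaussCoeff_two_mul, gaussCoeff_two_mul,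
      Nat.factorial_succ]
    have : (l.factorial : ℂ) ≠ 0 := by exact_mod_cast l.factorial_ne_zero
    have h2 : (l : ℂ) + 1 ≠ 0 := by exact_mod_cast l.succ_ne_zero
    push_cast
    field_simp
    ring
  · have h1 : ¬ Even (2 * l + 1) := by simp
    have h2 : ¬ Even (2 * l + 1 + 1 + 1) := by simp [Nat.even_add_one]
    simp [gaussCoeff, h1, h2]

theorem hasSum_of_hasSum_two_mul {E : Type*} [AddCommMonoid E] [TopologicalSpace E] {f : ℕ → E}
    {a : E} (h0 : ∀ j, ¬ Even j → f j = 0) (h : HasSum (fun l => f (2 * l)) a) : HasSum f a := by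
  refine (Function.Injective.hasSum_iff (mul_right_injective₀ (two_ne_zero' ℕ)) fun j hj => ?_).1 h
  refine h0 j fun he => hj ?_
  obtain ⟨l, rfl⟩ := he.two_dvd
  exact ⟨l, rfl⟩

theorem hasSum_gaussCoeff (c : ℂ) : HasSum (gaussCoeff c) (Complex.exp (c / 2)) := by
  refine hasSum_of_hasSum_two_mul (fun j hj => by simp [gaussCoeff, hj]) ?_
  simp_rw [gaussCoeff_two_mul]
  have := NormedSpace.expSeries_div_hasSum_exp (c / 2)
  rw [← Complex.exp_eq_exp_ℂ] at this
  simpa [div_eq_inv_mul] using this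

theorem summable_norm_gaussCoeff (c : ℂ) : Summable fun j => ‖gaussCoeff c j‖ :=
  (hasSum_gaussCoeff c).summable.norm

/-- Moving B to the left past each of the factors A costs one scalar c. -/
theorem pow_succ_mul_of_commutator {A B : 𝒜} {c : ℂ} (hAB : A * B - B * A = c • 1) (j : ℕ) :
    A ^ (j + 1) * B = B * A ^ (j + 1) + (((j : ℂ) + 1) * c) • A ^ j := by
  have h : A * B = B * A + c • 1 := by rw [← hAB]; abel
  induction j with
  | zero => simp [h]
  | succ j ih =>
    rw [pow_succ' A (j + 1), mul_assoc, ih, mul_add, ← mul_assoc, h, add_mul, mul_smul_comm,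
      ← pow_succ', smul_mul_assoc, one_mul, add_assoc, ← add_smul, mul_assoc]
    congr 2
    push_cast
    ring

/-- The divided power `A ^ k / k!`. -/
noncomputable def divPow (A : 𝒜) (k : ℕ) : 𝒜 := ((Nat.factorial k : ℂ)⁻¹) • A ^ k

theorem divPow_zero (A : 𝒜) : divPow A 0 = 1 := by simp [divPow]

theorem divPow_one (A : 𝒜) : divPow A 1 = A := by simp [divPow]

theorem succ_smul_divPow (A : 𝒜) (k : ℕ) :
    ((k : ℂ) + 1) • divPow A (k + 1) = A * divPow A k := by
  have h2 : (k : ℂ) + 1 ≠ 0 := by exact_mod_cast k.succ_ne_zero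
  rw [divPow, divPow, smul_smul, mul_smul_comm, ← pow_succ', Nat.factorial_succ]
  push_cast
  rw [mul_inv, mul_inv_cancel_left₀ h2]

theorem divPow_succ_mul_of_commutator {A B : 𝒜} {c : ℂ} (hAB : A * B - B * A = c • 1) (j : ℕ) :
    divPow A (j + 1) * B = B * divPow A (j + 1) + c • divPow A j := by
  have h2 : (j : ℂ) + 1 ≠ 0 := by exact_mod_cast j.succ_ne_zero
  rw [divPow, divPow, smul_mul_assoc, pow_succ_mul_of_commutator hAB, smul_add, mul_smul_comm,
    smul_smul, smul_smul, Nat.factorial_succ]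
  congr 2
  push_cast
  field_simp

/-- The Baker–Campbell–Hausdorff identity `e^{tA} e^{tB} = e^{t(A+B)} e^{ct²/2}` for a scalar
commutator `[A, B] = c`, as an identity of coefficients of `tⁿ`. -/
theorem sum_divPow_mul_divPow {A B : 𝒜} {c : ℂ} (hAB : A * B - B * A = c • 1) (n : ℕ) :
    ∑ p ∈ antidiagonal n, divPow A p.1 * divPow B p.2 =
      ∑ p ∈ antidiagonal n, gaussCoeff c p.2 • divPow (A + B) p.1 := by
  set U : ℕ → 𝒜 := fun n => ∑ p ∈ antidiagonal n, divPow A p.1 * divPow B p.2 with hU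
  set V : ℕ → 𝒜 := fun n =>
    ∑ p ∈ antidiagonal n, divPow (A + B) p.1 * (gaussCoeff c p.2 • (1 : 𝒜)) with hV
  -- Both generating series solve F' = (A + B + ct) F; for e^{tA} e^{tB} this uses e^{tA} B = (B +
  -- ct) e^{tA}. The resulting two-step recursion, with equal values in degrees 0 and 1, determines
  -- all coefficients.
  have hU2 : ∀ n : ℕ, ((n : ℂ) + 1 + 1) • U (n + 1 + 1) = (A + B) * U (n + 1) + c • U n := by
    intro n
    have h := succ_smul_sum_antidiagonal_mul (divPow A) (divPow B) (n + 1)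
    push_cast at h
    simp only [hU]
    rw [h]
    simp only [succ_smul_divPow, ← mul_assoc]
    rw [Nat.sum_antidiagonal_succ (f := fun p => divPow A p.1 * B * divPow B p.2)]
    simp only [divPow_succ_mul_of_commutator hAB, add_mul, mul_sum, sum_add_distrib, divPow_zero,
      one_mul, smul_mul_assoc, smul_sum]
    rw [Nat.sum_antidiagonal_succ (f := fun p => B * (divPow A p.1 * divPow B p.2))]
    simp only [divPow_zero, one_mul, mul_assoc]
    abel
  have hV2 : ∀ n : ℕ, ((n : ℂ) + 1 + 1) • V (n + 1 + 1) = (A + B) * V (n + 1) + c • V n := by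
    intro n
    have h := succ_smul_sum_antidiagonal_mul (divPow (A + B)) (fun j => gaussCoeff c j • (1 : 𝒜))
      (n + 1)
    push_cast at h
    simp only [hV]
    rw [h]
    simp only [succ_smul_divPow, smul_smul, mul_assoc, ← mul_sum]
    congr 1
    rw [Nat.sum_antidiagonal_succ']
    push_cast
    simp only [succ_mul_gaussCoeff]
    have h1 : gaussCoeff c (0 + 1) = 0 := by simp [gaussCoeff]
    simp only [h1, mul_zero, zero_smul, zero_add, mul_smul, mul_smul_comm, smul_sum]
  have h0 : U 0 = V 0 := by simp [hU, hV, divPow_zero, gaussCoeff]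
  have h1 : U 1 = V 1 := by
    have e1 : gaussCoeff c 1 = 0 := by simp [gaussCoeff]
    have e0 : gaussCoeff c 0 = 1 := by simp [gaussCoeff]
    simp [hU, hV, Nat.antidiagonal_succ, divPow_zero, divPow_one, e0, e1, add_comm]
  have key : ∀ n, U n = V n ∧ U (n + 1) = V (n + 1) := by
    intro n
    induction n with
    | zero => exact ⟨h0, h1⟩
    | succ n ih =>
      refine ⟨ih.2, ?_⟩
      have hn : (n : ℂ) + 1 + 1 ≠ 0 := by exact_mod_cast (n + 1).succ_ne_zero
      have := (hU2 n).trans (by rw [ih.1, ih.2, ← hV2 n])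
      exact smul_right_injective 𝒜 hn this
  have := (key n).1
  simpa [hU, hV, mul_smul_comm] using this

end Algebra

/-! ## Representations of the canonical commutation relations -/

theorem divPow_smul {𝒜 : Type*} [Ring 𝒜] [Algebra ℂ 𝒜] (t : ℂ) (A : 𝒜) (k : ℕ) :
    divPow (t • A) k = t ^ k • divPow A k := by
  rw [divPow, divPow, smul_pow, smul_comm]

/-- The double family of inner products is absolutely summable, so it may be regrouped by total
degree, which is the grading in which the Baker–Campbell–Hausdorff identity is stated. -/
theorem hasSum_antidiagonal_inner {H : Type*} [NormedAddCommGroup H] [InnerProductSpace ℂ H]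
    {f g : ℕ → H} {x y : H} (hf : HasSum f x) (hg : HasSum g y)
    (hf' : Summable fun k => ‖f k‖) (hg' : Summable fun k => ‖g k‖) :
    HasSum (fun n => ∑ p ∈ Finset.HasAntidiagonal.antidiagonal n, ⟪f p.1, g p.2⟫_ℂ) ⟪x, y⟫_ℂ := by
  have hF : Summable fun p : ℕ × ℕ => ⟪f p.1, g p.2⟫_ℂ :=
    Summable.of_norm_bounded
      (hf'.mul_of_nonneg hg' (fun _ => norm_nonneg _) (fun _ => norm_nonneg _))
      fun p => norm_inner_le_norm _ _
  have h1 : HasSum (fun i => ⟪f i, y⟫_ℂ) ⟪x, y⟫_ℂ := by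
    have := Complex.hasSum_conj'.2 (hf.mapL (innerSL ℂ y))
    simpa [inner_conj_symm] using this
  have h2 : ∀ i, HasSum (fun j => ⟪f i, g j⟫_ℂ) ⟪f i, y⟫_ℂ := fun i => hg.mapL (innerSL ℂ (f i))
  have h3 : HasSum (fun p : ℕ × ℕ => ⟪f p.1, g p.2⟫_ℂ) ⟪x, y⟫_ℂ := by
    have := hF.hasSum
    rwa [(this.prod_fiberwise h2).unique h1] at this
  have h4 := (Finset.HasAntidiagonal.sigmaAntidiagonalEquivProd (A := ℕ)).hasSum_iff.2 h3
  have h5 := h4.sigma fun n => hasSum_fintype _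
  refine h5.congr_fun fun n => ?_
  rw [Finset.univ_eq_attach,
    ← Finset.sum_attach (Finset.HasAntidiagonal.antidiagonal n) fun p => ⟪f p.1, g p.2⟫_ℂ]
  rfl

theorem commutator_sum_smul {𝒜 ι : Type*} [Ring 𝒜] [Algebra ℂ 𝒜] [Fintype ι] (x y : ι → 𝒜)
    (a b : ι → ℂ) :
    (∑ i, a i • x i) * (∑ i, b i • y i) - (∑ i, b i • y i) * ∑ i, a i • x i =
      ∑ i, ∑ j, (a i * b j) • (x i * y j - y j * x i) := by
  rw [Finset.sum_mul_sum, Finset.sum_mul_sum,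
    Finset.sum_comm (f := fun i j => b i • y i * a j • x j)]
  simp only [← Finset.sum_sub_distrib, smul_sub, smul_mul_smul_comm, mul_comm (b _)]

/-- The Hermitian product `∑ₘ αₘ βₘ^*`. -/
noncomputable def hermProd {M : ℕ} (α β : Fin M → ℂ) : ℂ := ∑ m, α m * conj (β m)

section CCR

variable {V H : Type*} [AddCommGroup V] [Module ℂ V] [NormedAddCommGroup H]
  [InnerProductSpace ℂ H] {M : ℕ}

/-- The operator `∑ₘ (αₘ aₘ† - αₘ^* aₘ)` of a family of creation and annihilation operators. -/
noncomputable def fieldGenerator (cr an : Fin M → Module.End ℂ V) (α : Fin M → ℂ) :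
    Module.End ℂ V :=
  ∑ m, (α m • cr m - conj (α m) • an m)

/-- The operators `D α` are the exponentials of the field operators of a representation of the
canonical commutation relations on a dense domain `V`. -/
structure IsWeylSystem (ι : V →ₗ[ℂ] H) (cr an : Fin M → Module.End ℂ V)
    (D : (Fin M → ℂ) → H →L[ℂ] H) : Prop where
  dense : DenseRange ι
  creation_comm : ∀ m m', cr m * cr m' - cr m' * cr m = 0
  annihilation_comm : ∀ m m', an m * an m' - an m' * an m = 0
  annihilation_creation : ∀ m m', an m * cr m' - cr m' * an m = if m = m' then 1 else 0
  inner_creation : ∀ m u v, ⟪ι (cr m u), ι v⟫_ℂ = ⟪ι u, ι (an m v)⟫_ℂ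
  hasSum : ∀ α v, HasSum (fun k => ι (divPow (fieldGenerator cr an α) k v)) (D α (ι v))

variable (cr an : Fin M → Module.End ℂ V)

theorem fieldGenerator_eq_sub (α : Fin M → ℂ) :
    fieldGenerator cr an α = (∑ m, α m • cr m) - ∑ m, conj (α m) • an m := by
  rw [fieldGenerator, Finset.sum_sub_distrib]

theorem fieldGenerator_add (α β : Fin M → ℂ) :
    fieldGenerator cr an (α + β) = fieldGenerator cr an α + fieldGenerator cr an β := by
  simp only [fieldGenerator, ← Finset.sum_add_distrib, Pi.add_apply, map_add, add_smul]
  exact Finset.sum_congr rfl fun m _ => by abel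

theorem fieldGenerator_smul (t : ℝ) (α : Fin M → ℂ) :
    fieldGenerator cr an (t • α) = (t : ℂ) • fieldGenerator cr an α := by
  simp only [fieldGenerator, Finset.smul_sum, smul_sub, smul_smul, Pi.smul_apply,
    Complex.real_smul, map_mul, Complex.conj_ofReal]

theorem fieldGenerator_neg (α : Fin M → ℂ) :
    fieldGenerator cr an (-α) = -fieldGenerator cr an α := by
  have := fieldGenerator_smul cr an (-1) α
  simpa using this

/-- Cauchy product of the scalar series of exp(c/2) with a matrix element of the exponential series:
the right-hand side of Baker–Campbell–Hausdorff at t = 1, in weak form. -/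
theorem hasSum_antidiagonal_gaussCoeff {ι : V →ₗ[ℂ] H} {A : Module.End ℂ V} {T : H →L[ℂ] H}
    {v : V} (c : ℂ)
    (hA : HasSum (fun k => ι (divPow A k v)) (T (ι v)))
    (hA' : Summable fun k => ‖ι (divPow A k v)‖) (x : H) :
    HasSum (fun n => ⟪x, ι ((∑ p ∈ Finset.HasAntidiagonal.antidiagonal n,
      gaussCoeff c p.2 • divPow A p.1) v)⟫_ℂ) (Complex.exp (c / 2) * ⟪x, T (ι v)⟫_ℂ) := by
  have h1 : HasSum (fun k => ⟪x, ι (divPow A k v)⟫_ℂ) ⟪x, T (ι v)⟫_ℂ := hA.mapL (innerSL ℂ x)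
  have h1' : Summable fun k => ‖⟪x, ι (divPow A k v)⟫_ℂ‖ :=
    Summable.of_nonneg_of_le (fun _ => norm_nonneg _) (fun _ => norm_inner_le_norm _ _)
      (hA'.mul_left ‖x‖)
  have h2 := (summable_norm_sum_mul_antidiagonal_of_summable_norm h1'
    (summable_norm_gaussCoeff c)).of_norm.hasSum
  rw [← tsum_mul_tsum_eq_tsum_sum_antidiagonal_of_summable_norm h1' (summable_norm_gaussCoeff c),
    h1.tsum_eq, (hasSum_gaussCoeff c).tsum_eq, mul_comm] at h2
  refine h2.congr_fun fun n => ?_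
  simp only [LinearMap.sum_apply, LinearMap.smul_apply, map_sum, map_smul, inner_sum,
    inner_smul_right]
  exact Finset.sum_congr rfl fun p _ => mul_comm _ _

variable {cr an} {ι : V →ₗ[ℂ] H} {D : (Fin M → ℂ) → H →L[ℂ] H}

namespace IsWeylSystem

theorem commutator_creation_annihilation (h : IsWeylSystem ι cr an D) (α β : Fin M → ℂ) :
    (∑ m, α m • cr m) * (∑ m, conj (β m) • an m) - (∑ m, conj (β m) • an m) * ∑ m, α m • cr m =
      -(hermProd α β • 1) := by
  have h1 : ∀ m m', cr m * an m' - an m' * cr m = if m = m' then -1 else 0 := fun m m' => by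
    rw [← neg_sub, h.annihilation_creation m' m]
    by_cases hm : m = m' <;> simp [hm, Ne.symm]
  rw [commutator_sum_smul]
  simp [h1, hermProd, Finset.sum_smul]

theorem commutator_fieldGenerator (h : IsWeylSystem ι cr an D) (α β : Fin M → ℂ) :
    fieldGenerator cr an α * fieldGenerator cr an β -
      fieldGenerator cr an β * fieldGenerator cr an α = (hermProd α β - hermProd β α) • 1 := by
  have h1 := h.commutator_creation_annihilation α β
  have h2 := h.commutator_creation_annihilation β α
  have h3 := commutator_sum_smul cr cr α β
  have h4 := commutator_sum_smul an an (fun m => conj (α m)) (fun m => conj (β m))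
  simp only [h.creation_comm, h.annihilation_comm, smul_zero, Finset.sum_const_zero] at h3 h4
  rw [fieldGenerator_eq_sub, fieldGenerator_eq_sub, sub_smul]
  have h5 : ∀ X Y X' Y' : Module.End ℂ V, (X - Y) * (X' - Y') - (X' - Y') * (X - Y) =
      (X * X' - X' * X) + (Y * Y' - Y' * Y) - (X * Y' - Y' * X) + (X' * Y - Y * X') := by
    intros
    noncomm_ring
  rw [h5, h1, h2, h3, h4]
  abel

/-- Convergence of the series at 2α keeps its terms bounded; these are 2^k times the terms at α, so
the latter are dominated by a geometric series. -/
theorem summable_norm (h : IsWeylSystem ι cr an D) (α : Fin M → ℂ) (v : V) :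
    Summable fun k => ‖ι (divPow (fieldGenerator cr an α) k v)‖ := by
  have h := (h.hasSum ((2 : ℝ) • α) v).summable.tendsto_atTop_zero.norm
  obtain ⟨C, hC⟩ := h.bddAbove_range
  refine Summable.of_nonneg_of_le (fun _ => norm_nonneg _) (fun k => ?_)
    ((summable_geometric_two).mul_left C)
  have hk := hC ⟨k, rfl⟩
  simp only [fieldGenerator_smul, divPow_smul, LinearMap.smul_apply, map_smul, norm_smul] at hk
  rw [one_div, inv_pow, ← div_eq_mul_inv, le_div_iff₀ (by positivity), mul_comm]
  simpa using hk

theorem inner_annihilation (h : IsWeylSystem ι cr an D) (m : Fin M) (u v : V) :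
    ⟪ι (an m u), ι v⟫_ℂ = ⟪ι u, ι (cr m v)⟫_ℂ := by
  rw [← inner_conj_symm, ← h.inner_creation, inner_conj_symm]

theorem inner_fieldGenerator (h : IsWeylSystem ι cr an D) (α : Fin M → ℂ) (u v : V) :
    ⟪ι (fieldGenerator cr an α u), ι v⟫_ℂ = ⟪ι u, ι (fieldGenerator cr an (-α) v)⟫_ℂ := by
  simp only [fieldGenerator, LinearMap.sum_apply, LinearMap.sub_apply,
      LinearMap.smul_apply, map_sum, map_sub, map_smul, sum_inner, inner_sum, inner_sub_left,
      inner_sub_right, inner_smul_left, inner_smul_right, h.inner_creation, h.inner_annihilation,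
      Complex.conj_conj, Pi.neg_apply, map_neg]
  exact Finset.sum_congr rfl fun m _ => by ring

theorem inner_divPow_fieldGenerator (h : IsWeylSystem ι cr an D) (α : Fin M → ℂ) (k : ℕ)
    (u v : V) :
    ⟪ι (divPow (fieldGenerator cr an α) k u), ι v⟫_ℂ =
      ⟪ι u, ι (divPow (fieldGenerator cr an (-α)) k v)⟫_ℂ := by
  have : ∀ u v, ⟪ι ((fieldGenerator cr an α ^ k) u), ι v⟫_ℂ =
      ⟪ι u, ι ((fieldGenerator cr an (-α) ^ k) v)⟫_ℂ := by
    induction k with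
    | zero => simp
    | succ k ih =>
      intro u v
      rw [pow_succ, Module.End.mul_apply, ih, h.inner_fieldGenerator, pow_succ',
        Module.End.mul_apply]
  simp [divPow, this, mul_comm]

theorem inner_apply_left (h : IsWeylSystem ι cr an D) (α : Fin M → ℂ) (x y : H) :
    ⟪D α x, y⟫_ℂ = ⟪x, D (-α) y⟫_ℂ := by
  have h0 : ∀ u v : V, ⟪D α (ι u), ι v⟫_ℂ = ⟪ι u, D (-α) (ι v)⟫_ℂ := fun u v => by
    have h1 := Complex.hasSum_conj'.2 ((h.hasSum α u).mapL (innerSL ℂ (ι v)))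
    have h2 := (h.hasSum (-α) v).mapL (innerSL ℂ (ι u))
    simp only [innerSL_apply_apply, inner_conj_symm, h.inner_divPow_fieldGenerator] at h1 h2
    exact h1.unique h2
  refine h.dense.induction_on₂ (p := fun x y => ⟪D α x, y⟫_ℂ = ⟪x, D (-α) y⟫_ℂ) ?_ h0 x y
  exact isClosed_eq (by fun_prop) (by fun_prop)

theorem adjoint [CompleteSpace H] (h : IsWeylSystem ι cr an D) (α : Fin M → ℂ) :
    ContinuousLinearMap.adjoint (D α) = D (-α) := by
  refine ContinuousLinearMap.ext fun x => ext_inner_left ℂ fun y => ?_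
  rw [ContinuousLinearMap.adjoint_inner_right, h.inner_apply_left]

/-- The Weyl relation. -/
theorem apply_apply (h : IsWeylSystem ι cr an D) (α β : Fin M → ℂ) (x : H) :
    D α (D β x) = Complex.exp ((hermProd α β - hermProd β α) / 2) • D (α + β) x := by
  set c := hermProd α β - hermProd β α with hc
  -- The vector D β (ι v) need not lie in the image of V, so no exponential series is available for
  -- D α on it. Moving D α to the left slot as D (-α) lets both series act on vectors of V.
  have h0 : ∀ u v : V, ⟪ι u, D α (D β (ι v))⟫_ℂ =
      Complex.exp (c / 2) * ⟪ι u, D (α + β) (ι v)⟫_ℂ := fun u v => by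
    have h1 := hasSum_antidiagonal_inner (h.hasSum (-α) u) (h.hasSum β v) (h.summable_norm (-α) u)
      (h.summable_norm β v)
    have h2 := hasSum_antidiagonal_gaussCoeff c (h.hasSum (α + β) v) (h.summable_norm (α + β) v)
      (ι u)
    rw [h.inner_apply_left, neg_neg] at h1
    refine h1.unique (h2.congr_fun fun n => ?_)
    rw [fieldGenerator_add, ← sum_divPow_mul_divPow
      (h.commutator_fieldGenerator α β)]
    simp only [LinearMap.sum_apply, map_sum, inner_sum, h.inner_divPow_fieldGenerator, neg_neg,
      Module.End.mul_apply]
  have h3 : D α ∘L D β = Complex.exp (c / 2) • D (α + β) := by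
    refine DFunLike.coe_injective (h.dense.equalizer (by fun_prop) (by fun_prop) ?_)
    funext v
    refine h.dense.eq_of_inner_right ℂ fun u => ?_
    simpa [inner_smul_right] using h0 u v
  exact congrArg (fun T => T x) h3

/-- Normal ordering: e^X e^{-Y} = e^{X-Y} e^{⟨β,β⟩/2} with X built from creation and Y from
annihilation operators. Y kills the vacuum on the right and the adjoint of X kills it on the left,
so only the degree-zero term of e^X e^{-Y} contributes. -/
theorem inner_vacuum (h : IsWeylSystem ι cr an D) {v₀ : V} (hv : ∀ m, an m v₀ = 0) (hn : ‖ι v₀‖ = 1)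
    (β : Fin M → ℂ) :
    ⟪ι v₀, D β (ι v₀)⟫_ℂ = Complex.exp (-hermProd β β / 2) := by
  set X := ∑ m, β m • cr m with hX
  set Y := ∑ m, conj (β m) • an m with hY
  have hYv : Y v₀ = 0 := by simp [hY, hv]
  have hXY : X * (-Y) - (-Y) * X = hermProd β β • 1 := by
    rw [mul_neg, neg_mul, ← neg_sub', h.commutator_creation_annihilation, neg_neg]
  have h1 := hasSum_antidiagonal_gaussCoeff (hermProd β β) (h.hasSum β v₀)
    (h.summable_norm β v₀) (ι v₀)
  have hYk : ∀ k, divPow (-Y) (k + 1) v₀ = 0 := fun k => by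
    simp [divPow, pow_succ, hYv]
  have hXk : ∀ k, ⟪ι v₀, ι (divPow X (k + 1) v₀)⟫_ℂ = 0 := fun k => by
    have : ∀ u, ⟪ι v₀, ι (X u)⟫_ℂ = 0 := fun u => by
      simp [hX, ← h.inner_annihilation, hv]
    rw [divPow, LinearMap.smul_apply, pow_succ', Module.End.mul_apply, map_smul, inner_smul_right,
      this, mul_zero]
  have h2 : ∀ n, ⟪ι v₀, ι ((∑ p ∈ Finset.HasAntidiagonal.antidiagonal n,
      gaussCoeff (hermProd β β) p.2 • divPow (fieldGenerator cr an β) p.1) v₀)⟫_ℂ =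
        if n = 0 then 1 else 0 := by
    intro n
    rw [fieldGenerator_eq_sub, sub_eq_add_neg, ← sum_divPow_mul_divPow hXY]
    rcases n with _ | n
    · simp [divPow_zero, inner_self_eq_norm_sq_to_K, hn]
    · rw [Finset.Nat.sum_antidiagonal_succ']
      simp [hYk, hXk, divPow_zero]
  simp only [h2] at h1
  have h3 := h1.unique (hasSum_ite_eq 0 (1 : ℂ))
  rw [neg_div, Complex.exp_neg, eq_inv_of_mul_eq_one_right h3]

end IsWeylSystem
end CCR

/-! ### Isometry, differentiation and parity in a Weyl system -/

section CCR

open Filter Topology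

variable {V H : Type*} [AddCommGroup V] [Module ℂ V] [NormedAddCommGroup H]
  [InnerProductSpace ℂ H] {M : ℕ} {cr an : Fin M → Module.End ℂ V} {ι : V →ₗ[ℂ] H}
  {D : (Fin M → ℂ) → H →L[ℂ] H}

namespace IsWeylSystem

theorem apply_zero (h : IsWeylSystem ι cr an D) (x : H) : D 0 x = x := by
  have h0 : ∀ v, D 0 (ι v) = ι v := fun v => by
    refine (h.hasSum 0 v).unique ?_
    have : fieldGenerator cr an 0 = 0 := by simp [fieldGenerator]
    convert hasSum_ite_eq 0 (ι v) using 2 with k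
    rcases k with _ | k <;> simp [this, divPow]
  exact congrFun (h.dense.equalizer (D 0).continuous continuous_id (funext h0)) x

theorem norm_apply (h : IsWeylSystem ι cr an D) (α : Fin M → ℂ) (x : H) : ‖D α x‖ = ‖x‖ := by
  have h1 : ⟪D α x, D α x⟫_ℂ = ⟪x, x⟫_ℂ := by
    rw [h.inner_apply_left, h.apply_apply, neg_add_cancel, h.apply_zero]
    simp [hermProd]
  rw [inner_self_eq_norm_sq_to_K, inner_self_eq_norm_sq_to_K] at h1
  have h' : ‖D α x‖ ^ 2 = ‖x‖ ^ 2 := by exact_mod_cast h1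
  exact (sq_eq_sq₀ (norm_nonneg _) (norm_nonneg _)).1 h'

/-- The field operator is the derivative of `t ↦ D (t α)` at `0`. -/
theorem tendsto_slope [CompleteSpace H] (h : IsWeylSystem ι cr an D) (α : Fin M → ℂ) (v : V) :
    Tendsto (fun n : ℕ => ((n : ℂ) + 1) • (D ((1 / ((n : ℝ) + 1)) • α) (ι v) - ι v)) atTop
      (𝓝 (ι (fieldGenerator cr an α v))) := by
  set d : ℕ → H := fun k => ι (divPow (fieldGenerator cr an α) k v) with hd
  have hs : Summable fun k => ‖d (k + 1)‖ := (summable_nat_add_iff 1).2 (h.summable_norm α v)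
  have h1 : ∀ n : ℕ, ((n : ℂ) + 1) • (D ((1 / ((n : ℝ) + 1)) • α) (ι v) - ι v) =
      ∑' k, ((1 / ((n : ℂ) + 1)) ^ k) • d (k + 1) := by
    intro n
    have hn : (n : ℂ) + 1 ≠ 0 := by exact_mod_cast n.succ_ne_zero
    have h2 := h.hasSum ((1 / ((n : ℝ) + 1)) • α) v
    rw [← hasSum_nat_add_iff' 1] at h2
    have h3 := h2.const_smul ((n : ℂ) + 1)
    simp only [Finset.sum_range_one, divPow_zero, Module.End.one_apply] at h3
    rw [← h3.tsum_eq]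
    refine tsum_congr fun k => ?_
    rw [fieldGenerator_smul, divPow_smul, LinearMap.smul_apply, map_smul, smul_smul, pow_succ']
    push_cast
    rw [← mul_assoc, mul_one_div_cancel hn, one_mul]
  simp_rw [h1]
  have h4 : ι (fieldGenerator cr an α v) = ∑' k, if k = 0 then d 1 else 0 := by
    rw [tsum_ite_eq, hd]
    simp [divPow_one]
  rw [h4]
  have h5 : Tendsto (fun n : ℕ => 1 / ((n : ℂ) + 1)) atTop (𝓝 0) := by
    have := (Complex.continuous_ofReal.tendsto 0).comp tendsto_one_div_add_atTop_nhds_zero_nat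
    simpa [Function.comp_def] using this
  -- With t = 1/(n+1), the difference quotient is ∑ t^k d_{k+1}. Since t ≤ 1 it is dominated by ∑
  -- ‖d_{k+1}‖, and only the term k = 0 survives as t → 0.
  refine tendsto_tsum_of_dominated_convergence hs (fun k => ?_) (Eventually.of_forall fun n k => ?_)
  · rcases k with _ | k
    · simp
    · have := (h5.pow (k + 1)).smul_const (d (k + 1 + 1))
      simpa using this
  · rw [norm_smul, norm_pow]
    refine mul_le_of_le_one_left (norm_nonneg _) (pow_le_one₀ (norm_nonneg _) ?_)
    have : ((n : ℂ) + 1) = (((n : ℝ) + 1 : ℝ) : ℂ) := by push_cast; rfl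
    rw [this, norm_div, Complex.norm_real, Real.norm_of_nonneg (by positivity), norm_one]
    exact (div_le_one (by positivity)).2 (by linarith [(Nat.cast_nonneg n : (0 : ℝ) ≤ n)])

/-- Differentiating the displacements inside the closed subspace puts the field operators applied to
v in K. The directions 1 and i of mode m give a† - a and i(a† + a), from which a† is a complex
linear combination. -/
theorem creation_mem [CompleteSpace H] (h : IsWeylSystem ι cr an D) {K : Submodule ℂ H}
    (hK : IsClosed (K : Set H)) (hD : ∀ α, ∀ x ∈ K, D α x ∈ K) {v : V} (hv : ι v ∈ K)
    (m : Fin M) : ι (cr m v) ∈ K := by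
  have h1 : ∀ α, ι (fieldGenerator cr an α v) ∈ K := fun α =>
    hK.mem_of_tendsto (h.tendsto_slope α v)
      (Eventually.of_forall fun n => K.smul_mem _ (K.sub_mem (hD _ _ hv) hv))
  have h2 : ∀ z : ℂ, fieldGenerator cr an (Pi.single m z) v = z • cr m v - conj z • an m v := by
    intro z
    simp only [fieldGenerator, LinearMap.sum_apply, LinearMap.sub_apply, LinearMap.smul_apply]
    rw [Finset.sum_eq_single m (fun i _ hi => by simp [Pi.single_eq_of_ne hi]) (by simp)]
    simp
  have h3 : cr m v = (1 / 2 : ℂ) • (fieldGenerator cr an (Pi.single m 1) v -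
      Complex.I • fieldGenerator cr an (Pi.single m Complex.I) v) := by
    rw [h2, h2]
    simp only [Complex.conj_I, map_one, neg_smul, one_smul, sub_neg_eq_add, smul_add, smul_sub,
      smul_smul Complex.I Complex.I, Complex.I_mul_I]
    module
  rw [h3, map_smul, map_sub, map_smul]
  exact K.smul_mem _ (K.sub_mem (h1 _) (K.smul_mem _ (h1 _)))

/-- Anticommuting with every ladder operator, P reverses the sign of the field generator, hence
carries its exponential series for α termwise to the one for -α. -/
theorem parity_apply (h : IsWeylSystem ι cr an D) {T : H →L[ℂ] H} {P : Module.End ℂ V}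
    (hT : ∀ v, T (ι v) = ι (P v)) (hcr : ∀ m v, P (cr m v) = -cr m (P v))
    (han : ∀ m v, P (an m v) = -an m (P v)) (α : Fin M → ℂ) (x : H) :
    T (D α x) = D (-α) (T x) := by
  have h1 : ∀ v, P (fieldGenerator cr an α v) = fieldGenerator cr an (-α) (P v) := fun v => by
    rw [fieldGenerator_neg]
    simp only [fieldGenerator, LinearMap.neg_apply, LinearMap.sum_apply, LinearMap.sub_apply,
      LinearMap.smul_apply, map_sum, map_sub, map_smul, hcr, han, ← Finset.sum_neg_distrib]
    exact Finset.sum_congr rfl fun m _ => by module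
  have h2 : ∀ k v, P (divPow (fieldGenerator cr an α) k v) =
      divPow (fieldGenerator cr an (-α)) k (P v) := fun k v => by
    have : ∀ v, P ((fieldGenerator cr an α ^ k) v) = (fieldGenerator cr an (-α) ^ k) (P v) := by
      induction k with
      | zero => simp
      | succ k ih =>
        intro v
        rw [pow_succ, Module.End.mul_apply, ih, h1, pow_succ, Module.End.mul_apply]
    simp [divPow, this]
  have h3 : ∀ v, T (D α (ι v)) = D (-α) (T (ι v)) := fun v => by
    have h4 := (h.hasSum α v).mapL T
    simp only [hT, h2] at h4
    rw [hT]
    exact h4.unique (h.hasSum (-α) (P v))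
  exact congrFun (h.dense.equalizer (T ∘L D α).continuous (D (-α) ∘L T).continuous (funext h3)) x

end IsWeylSystem
end CCR

/-! ## The Weyl relations on Fock space -/

section Fock

variable {M : ℕ}

theorem creation_single (m : Fin M) (n : Fin M → ℕ) (c : ℂ) :
    creation m (Finsupp.single n c) = Finsupp.single (Function.update n m (n m + 1))
      (c * ((Real.sqrt ((n m : ℝ) + 1) : ℝ) : ℂ)) := by
  simp [creation]

theorem annihilation_single (m : Fin M) (n : Fin M → ℕ) (c : ℂ) :
    annihilation m (Finsupp.single n c) = Finsupp.single (Function.update n m (n m - 1))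
      (c * ((Real.sqrt (n m : ℝ) : ℝ) : ℂ)) := by
  simp [annihilation]

theorem creation_creation (m m' : Fin M) (v : FiniteVec M) :
    creation m (creation m' v) = creation m' (creation m v) := by
  induction v using Finsupp.induction_linear with
  | zero => simp
  | add u v hu hv => simp only [map_add, hu, hv]
  | single n c =>
    simp only [creation_single]
    by_cases h : m = m'
    · subst h; rfl
    · rw [Function.update_comm h, Function.update_of_ne h, Function.update_of_ne (Ne.symm h)]
      congr 1
      ring

theorem annihilation_annihilation (m m' : Fin M) (v : FiniteVec M) :
    annihilation m (annihilation m' v) = annihilation m' (annihilation m v) := by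
  induction v using Finsupp.induction_linear with
  | zero => simp
  | add u v hu hv => simp only [map_add, hu, hv]
  | single n c =>
    simp only [annihilation_single]
    by_cases h : m = m'
    · subst h; rfl
    · rw [Function.update_comm h, Function.update_of_ne h, Function.update_of_ne (Ne.symm h)]
      congr 1
      ring

theorem annihilation_creation_of_ne {m m' : Fin M} (h : m ≠ m') (v : FiniteVec M) :
    annihilation m (creation m' v) = creation m' (annihilation m v) := by
  induction v using Finsupp.induction_linear with
  | zero => simp
  | add u v hu hv => simp only [map_add, hu, hv]
  | single n c =>
    simp only [annihilation_single, creation_single]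
    rw [Function.update_comm h, Function.update_of_ne h, Function.update_of_ne (Ne.symm h)]
    congr 1
    ring

theorem annihilation_creation_self (m : Fin M) (v : FiniteVec M) :
    annihilation m (creation m v) = creation m (annihilation m v) + v := by
  induction v using Finsupp.induction_linear with
  | zero => simp
  | add u v hu hv => simp only [map_add, hu, hv]; abel
  | single n c =>
    simp only [annihilation_single, creation_single]
    have e1 : ((Real.sqrt ((n m : ℝ) + 1) : ℝ) : ℂ) * ((Real.sqrt ((n m : ℝ) + 1) : ℝ) : ℂ) =
        (n m : ℂ) + 1 := by
      rw [← Complex.ofReal_mul, Real.mul_self_sqrt (by positivity)]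
      push_cast; rfl
    -- For an empty mode the truncated subtraction gives a wrong occupation number, but its
    -- coefficient √0 vanishes.
    by_cases h0 : n m = 0
    · have h1 : Function.update n m 0 = n := by rw [← h0, Function.update_eq_self]
      simp [h0, h1]
    · have h1 : n m - 1 + 1 = n m := Nat.sub_add_cancel (Nat.one_le_iff_ne_zero.2 h0)
      have h2 : (((n m - 1 : ℕ) : ℝ) + 1) = (n m : ℝ) := by exact_mod_cast h1
      have e2 : ((Real.sqrt (n m : ℝ) : ℝ) : ℂ) * ((Real.sqrt (n m : ℝ) : ℝ) : ℂ) = n m := by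
        rw [← Complex.ofReal_mul, Real.mul_self_sqrt (by positivity)]
        push_cast; rfl
      simp only [Function.update_self, Function.update_idem, h1, h2, Nat.add_sub_cancel,
        Function.update_eq_self, Nat.cast_add, Nat.cast_one, mul_assoc, e1, e2]
      rw [← Finsupp.single_add]
      congr 1
      ring

theorem isWeylSystem_displacement (M : ℕ) :
    IsWeylSystem (V := FiniteVec M) (embed M) creation annihilation displacement where
  dense := denseRange_embed M
  creation_comm m m' := by
    refine LinearMap.ext fun v => ?_
    exact sub_eq_zero.2 (creation_creation m m' v)
  annihilation_comm m m' := by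
    refine LinearMap.ext fun v => ?_
    exact sub_eq_zero.2 (annihilation_annihilation m m' v)
  annihilation_creation m m' := by
    refine LinearMap.ext fun v => ?_
    by_cases h : m = m'
    · subst h
      rw [if_pos rfl]
      exact sub_eq_iff_eq_add'.2 (annihilation_creation_self m v)
    · rw [if_neg h]
      exact sub_eq_zero.2 (annihilation_creation_of_ne h v)
  inner_creation := inner_creation
  hasSum α v := by
    refine (isExp_displacement α v).congr_fun fun k => ?_
    exact (map_smul (embed M) _ _)

theorem adjoint_displacement (α : Fin M → ℂ) :
    ContinuousLinearMap.adjoint (displacement α) = displacement (-α) :=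
  (isWeylSystem_displacement M).adjoint α

theorem displacement_displacement (α β : Fin M → ℂ) (x : FockSpace M) :
    displacement α (displacement β x) =
      Complex.exp ((hermProd α β - hermProd β α) / 2) • displacement (α + β) x :=
  (isWeylSystem_displacement M).apply_apply α β x

theorem inner_displacement_left (α : Fin M → ℂ) (x y : FockSpace M) :
    ⟪displacement α x, y⟫_ℂ = ⟪x, displacement (-α) y⟫_ℂ :=
  (isWeylSystem_displacement M).inner_apply_left α x y

theorem norm_displacement_apply (α : Fin M → ℂ) (x : FockSpace M) :
    ‖displacement α x‖ = ‖x‖ :=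
  (isWeylSystem_displacement M).norm_apply α x

theorem embed_single_one (n : Fin M → ℕ) : embed M (Finsupp.single n 1) = numberBasis M n := by
  rw [embed_single, one_smul]

theorem inner_vacuum_displacement (β : Fin M → ℂ) :
    ⟪numberBasis M 0, displacement β (numberBasis M 0)⟫_ℂ =
      Complex.exp (-hermProd β β / 2) := by
  rw [← embed_single_one]
  refine (isWeylSystem_displacement M).inner_vacuum (fun m => ?_) ?_ β
  · rw [annihilation_single]; simp
  · rw [norm_embed_single, norm_one]

theorem displacement_zero (x : FockSpace M) : displacement 0 x = x :=
  (isWeylSystem_displacement M).apply_zero x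

theorem embed_creation_mem {K : Submodule ℂ (FockSpace M)} (hK : IsClosed (K : Set (FockSpace M)))
    (hD : ∀ α, ∀ x ∈ K, displacement α x ∈ K) {v : FiniteVec M} (hv : embed M v ∈ K)
    (m : Fin M) : embed M (creation m v) ∈ K :=
  (isWeylSystem_displacement M).creation_mem hK hD hv m

theorem numberBasis_mem_of_update {K : Submodule ℂ (FockSpace M)}
    (hK : IsClosed (K : Set (FockSpace M))) (hD : ∀ α, ∀ x ∈ K, displacement α x ∈ K)
    {n : Fin M → ℕ} {m : Fin M} (hm : n m ≠ 0)
    (h : numberBasis M (Function.update n m (n m - 1)) ∈ K) : numberBasis M n ∈ K := by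
  have h1 : n m - 1 + 1 = n m := Nat.sub_add_cancel (Nat.one_le_iff_ne_zero.2 hm)
  rw [← embed_single_one] at h
  have h4 := embed_creation_mem hK hD h m
  rw [creation_single, Function.update_self, Function.update_idem, h1, Function.update_eq_self,
    embed_single] at h4
  refine (K.smul_mem_iff ?_).1 h4
  have : 0 < Real.sqrt (((n m - 1 : ℕ) : ℝ) + 1) := Real.sqrt_pos.2 (by positivity)
  rw [one_mul]
  exact_mod_cast this.ne'

/-- The vacuum is cyclic: induction on the total occupation number, each step raising one occupied
mode by a creation operator, which K absorbs. -/
theorem numberBasis_mem {K : Submodule ℂ (FockSpace M)}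
    (hK : IsClosed (K : Set (FockSpace M))) (hD : ∀ α, ∀ x ∈ K, displacement α x ∈ K)
    (h0 : numberBasis M 0 ∈ K) (s : ℕ) :
    ∀ n : Fin M → ℕ, ∑ m, n m = s → numberBasis M n ∈ K := by
  induction s with
  | zero =>
    intro n hn
    have : n = 0 := by
      funext m
      exact (Finset.sum_eq_zero_iff.1 hn) m (Finset.mem_univ m)
    rwa [this]
  | succ s ih =>
    intro n hn
    obtain ⟨m, hm⟩ : ∃ m, n m ≠ 0 := by
      by_contra! h0
      simp [h0] at hn
    refine numberBasis_mem_of_update hK hD hm (ih _ ?_)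
    rw [Finset.sum_update_of_mem (Finset.mem_univ m)]
    rw [← Finset.add_sum_erase _ _ (Finset.mem_univ m)] at hn
    rw [Finset.sdiff_singleton_eq_erase]
    omega

/-- The span of the coherent states. -/
noncomputable def coherentSpan (M : ℕ) : Submodule ℂ (FockSpace M) :=
  Submodule.span ℂ (Set.range fun γ : Fin M → ℂ => displacement γ (numberBasis M 0))

theorem displacement_mem_coherentSpan (α : Fin M → ℂ) {x : FockSpace M}
    (hx : x ∈ coherentSpan M) : displacement α x ∈ coherentSpan M := by
  refine Submodule.span_induction ?_ ?_ ?_ ?_ hx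
  · rintro _ ⟨γ, rfl⟩
    beta_reduce
    rw [displacement_displacement]
    exact Submodule.smul_mem _ _ (Submodule.subset_span ⟨α + γ, rfl⟩)
  · rw [map_zero]
    exact Submodule.zero_mem _
  · intro x y _ _ hx hy
    rw [map_add]
    exact Submodule.add_mem _ hx hy
  · intro c x _ hx
    rw [map_smul]
    exact Submodule.smul_mem _ _ hx

theorem displacement_mem_closure_coherentSpan (α : Fin M → ℂ) {x : FockSpace M}
    (hx : x ∈ (coherentSpan M).topologicalClosure) :
    displacement α x ∈ (coherentSpan M).topologicalClosure :=
  map_mem_closure (displacement α).continuous hx fun _ => displacement_mem_coherentSpan α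

/-- The coherent states are total in Fock space. -/
theorem dense_coherentSpan (M : ℕ) : Dense (coherentSpan M : Set (FockSpace M)) := by
  have h0 : numberBasis M 0 ∈ (coherentSpan M).topologicalClosure :=
    Submodule.le_topologicalClosure _ (Submodule.subset_span ⟨0, displacement_zero _⟩)
  rw [Submodule.dense_iff_topologicalClosure_eq_top, eq_top_iff, ← (numberBasis M).dense_span]
  refine Submodule.topologicalClosure_minimal _ (Submodule.span_le.2 ?_)
    (Submodule.isClosed_topologicalClosure _)
  rintro _ ⟨n, rfl⟩
  exact numberBasis_mem (Submodule.isClosed_topologicalClosure _)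
    (fun α _ => displacement_mem_closure_coherentSpan α) h0 _ n rfl

/-! ### Parity on Fock space -/

theorem parityGenerator_pow_single (n : Fin M → ℕ) (k : ℕ) :
    (parityGenerator M ^ k) (Finsupp.single n 1) =
      (-(Complex.I * (Real.pi : ℂ)) * ((∑ m, n m : ℕ) : ℂ)) ^ k • Finsupp.single n (1 : ℂ) := by
  induction k with
  | zero => simp
  | succ k ih =>
    rw [pow_succ', Module.End.mul_apply, ih, map_smul, parityGenerator_single, smul_smul, pow_succ]

theorem parity_numberBasis (n : Fin M → ℕ) :
    parity M (numberBasis M n) = ((-1 : ℂ) ^ ∑ m, n m) • numberBasis M n := by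
  set c := -(Complex.I * (Real.pi : ℂ)) * ((∑ m, n m : ℕ) : ℂ) with hc
  have h := isExp_parity M (Finsupp.single n 1)
  simp only [parityGenerator_pow_single, map_smul, smul_smul, embed_single_one] at h
  have h2 : HasSum (fun k : ℕ => ((k.factorial : ℂ)⁻¹) * c ^ k) (Complex.exp c) := by
    have := NormedSpace.expSeries_div_hasSum_exp c
    rw [← Complex.exp_eq_exp_ℂ] at this
    simpa [div_eq_inv_mul] using this
  have h3 : Complex.exp c = (-1 : ℂ) ^ ∑ m, n m := by
    rw [hc, mul_comm, Complex.exp_nat_mul, Complex.exp_neg, mul_comm, Complex.exp_pi_mul_I]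
    norm_num
  rw [h3] at h2
  exact h.unique (h2.smul_const _)

/-- The parity operator on finite vectors. -/
noncomputable def finiteParity (M : ℕ) : FiniteVec M →ₗ[ℂ] FiniteVec M :=
  Finsupp.linearCombination ℂ fun n => Finsupp.single n ((-1 : ℂ) ^ ∑ m, n m)

theorem finiteParity_single (n : Fin M → ℕ) (c : ℂ) :
    finiteParity M (Finsupp.single n c) = Finsupp.single n (c * (-1 : ℂ) ^ ∑ m, n m) := by
  simp [finiteParity]

theorem parity_embed (v : FiniteVec M) : parity M (embed M v) = embed M (finiteParity M v) := by
  induction v using Finsupp.induction_linear with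
  | zero => simp
  | add u v hu hv => simp only [map_add, hu, hv]
  | single n c =>
    rw [embed_single, map_smul, parity_numberBasis, finiteParity_single, embed_single, smul_smul]

theorem neg_one_pow_sum_update (n : Fin M → ℕ) (m : Fin M) :
    (-1 : ℂ) ^ (∑ i, Function.update n m (n m + 1) i) = -(-1 : ℂ) ^ ∑ i, n i := by
  rw [Finset.sum_update_of_mem (Finset.mem_univ m), ← Finset.add_sum_erase _ n (Finset.mem_univ m),
    Finset.sdiff_singleton_eq_erase]
  ring

theorem finiteParity_creation (m : Fin M) (v : FiniteVec M) :
    finiteParity M (creation m v) = -creation m (finiteParity M v) := by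
  induction v using Finsupp.induction_linear with
  | zero => simp
  | add u v hu hv => simp only [map_add, hu, hv]; abel
  | single n c =>
    simp only [creation_single, finiteParity_single, neg_one_pow_sum_update]
    rw [← Finsupp.single_neg]
    congr 1
    ring

theorem finiteParity_annihilation (m : Fin M) (v : FiniteVec M) :
    finiteParity M (annihilation m v) = -annihilation m (finiteParity M v) := by
  induction v using Finsupp.induction_linear with
  | zero => simp
  | add u v hu hv => simp only [map_add, hu, hv]; abel
  | single n c =>
    simp only [annihilation_single, finiteParity_single]
    rw [← Finsupp.single_neg]
    by_cases h0 : n m = 0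
    · simp [h0]
    · have h1 : n m - 1 + 1 = n m := Nat.sub_add_cancel (Nat.one_le_iff_ne_zero.2 h0)
      have h2 := neg_one_pow_sum_update (Function.update n m (n m - 1)) m
      simp only [Function.update_self, Function.update_idem, h1, Function.update_eq_self] at h2
      rw [h2]
      congr 1
      ring

theorem parity_displacement (α : Fin M → ℂ) (x : FockSpace M) :
    parity M (displacement α x) = displacement (-α) (parity M x) :=
  (isWeylSystem_displacement M).parity_apply parity_embed finiteParity_creation
    finiteParity_annihilation α x

theorem parity_vacuum : parity M (numberBasis M 0) = numberBasis M 0 := by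
  simp [parity_numberBasis]

/-- Since Π D(-α) = D(α) Π, the product D(α) Π D(α)† is D(α) D(α) Π, and the Weyl phase of α with
itself is trivial. This reduces displaced parities to displacements. -/
theorem displacedParity_apply (α : Fin M → ℂ) (x : FockSpace M) :
    displacedParity α x = displacement ((2 : ℂ) • α) (parity M x) := by
  rw [displacedParity, ContinuousLinearMap.comp_apply, ContinuousLinearMap.comp_apply,
    adjoint_displacement, parity_displacement, neg_neg, displacement_displacement, sub_self,
    two_smul]
  simp

end Fock

/-! ## Gaussian integrals -/

section Gaussian

open MeasureTheory

variable {M : ℕ}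

theorem hermProd_add_left (α β γ : Fin M → ℂ) :
    hermProd (α + β) γ = hermProd α γ + hermProd β γ := by
  simp [hermProd, add_mul, Finset.sum_add_distrib]

theorem hermProd_add_right (α β γ : Fin M → ℂ) :
    hermProd α (β + γ) = hermProd α β + hermProd α γ := by
  simp [hermProd, mul_add, Finset.sum_add_distrib]

theorem hermProd_smul_left (c : ℂ) (α β : Fin M → ℂ) :
    hermProd (c • α) β = c * hermProd α β := by
  simp [hermProd, Finset.mul_sum, mul_assoc]

theorem hermProd_smul_right (c : ℂ) (α β : Fin M → ℂ) :
    hermProd α (c • β) = conj c * hermProd α β := by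
  simp [hermProd, Finset.mul_sum, mul_left_comm]

theorem hermProd_neg_left (α β : Fin M → ℂ) : hermProd (-α) β = -hermProd α β := by
  simp [hermProd]

theorem hermProd_neg_right (α β : Fin M → ℂ) : hermProd α (-β) = -hermProd α β := by
  simp [hermProd]

theorem conj_hermProd (α β : Fin M → ℂ) : conj (hermProd α β) = hermProd β α := by
  simp [hermProd, mul_comm]

theorem hermProd_self (α : Fin M → ℂ) : hermProd α α = ((∑ m, ‖α m‖ ^ 2 : ℝ) : ℂ) := by
  simp [hermProd, Complex.mul_conj']

theorem continuous_hermProd {X : Type*} [TopologicalSpace X] {f g : X → Fin M → ℂ}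
    (hf : Continuous f) (hg : Continuous g) : Continuous fun x => hermProd (f x) (g x) := by
  unfold hermProd
  fun_prop

/-- In real coordinates the integrand factors into two one-dimensional Gaussians with linear
coefficients c + d and i(c - d); the exponents combine through (c + d)² - (c - d)² = 4cd. -/
theorem integral_cexp_complex {b : ℝ} (hb : 0 < b) (c d : ℂ) :
    ∫ z : ℂ, Complex.exp (-b * (z * conj z) + z * c + d * conj z) =
      (Real.pi / b) * Complex.exp (c * d / b) := by
  have hb' : (b : ℂ) ≠ 0 := by exact_mod_cast hb.ne'
  rw [← (Complex.volume_preserving_equiv_real_prod.symm).integral_comp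
    Complex.measurableEquivRealProd.symm.measurableEmbedding]
  have h1 : ∀ p : ℝ × ℝ, Complex.exp (-b * (Complex.measurableEquivRealProd.symm p *
      conj (Complex.measurableEquivRealProd.symm p)) + Complex.measurableEquivRealProd.symm p * c +
      d * conj (Complex.measurableEquivRealProd.symm p)) =
      Complex.exp (-(b : ℂ) * (p.1 : ℂ) ^ 2 + (c + d) * (p.1 : ℂ) + 0) *
        Complex.exp (-(b : ℂ) * (p.2 : ℂ) ^ 2 + (Complex.I * (c - d)) * (p.2 : ℂ) + 0) := by
    intro p
    have h2 : Complex.measurableEquivRealProd.symm p = p.1 + p.2 * Complex.I := by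
      rw [Complex.measurableEquivRealProd_symm_apply, Complex.mk_eq_add_mul_I]
    rw [h2, ← Complex.exp_add]
    congr 1
    simp only [map_add, map_mul, Complex.conj_ofReal, Complex.conj_I]
    linear_combination (b : ℂ) * (p.2 : ℂ) ^ 2 * Complex.I_sq
  simp_rw [h1]
  have hre : (-(b : ℂ)).re < 0 := by simpa using hb
  rw [Measure.volume_eq_prod, integral_prod_mul
    (fun x : ℝ => Complex.exp (-(b : ℂ) * (x : ℂ) ^ 2 + (c + d) * (x : ℂ) + 0))
    (fun x : ℝ => Complex.exp (-(b : ℂ) * (x : ℂ) ^ 2 + (Complex.I * (c - d)) * (x : ℂ) + 0)),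
    integral_cexp_quadratic hre, integral_cexp_quadratic hre, neg_neg]
  have h3 : ((Real.pi : ℂ) / b) ^ (1 / 2 : ℂ) * ((Real.pi : ℂ) / b) ^ (1 / 2 : ℂ) =
      Real.pi / b := by
    have h0 : (Real.pi : ℂ) / b ≠ 0 := div_ne_zero (by exact_mod_cast Real.pi_ne_zero) hb'
    rw [← Complex.cpow_add _ _ h0]
    norm_num
  rw [mul_mul_mul_comm, h3, ← Complex.exp_add]
  congr 2
  field_simp
  linear_combination (c - d) ^ 2 * Complex.I_sq

theorem integral_cexp_hermProd {b : ℝ} (hb : 0 < b) (β γ : Fin M → ℂ) (k : ℂ) :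
    ∫ α : Fin M → ℂ, Complex.exp (-b * hermProd α α + hermProd α β + hermProd γ α + k) =
      (Real.pi / b) ^ M * Complex.exp (hermProd γ β / b + k) := by
  have h1 : ∀ α : Fin M → ℂ,
      Complex.exp (-b * hermProd α α + hermProd α β + hermProd γ α + k) = Complex.exp k *
        ∏ m, Complex.exp (-b * (α m * conj (α m)) + α m * conj (β m) + γ m * conj (α m)) := by
    intro α
    rw [← Complex.exp_sum, ← Complex.exp_add, Finset.sum_add_distrib, Finset.sum_add_distrib,
      ← Finset.mul_sum, add_comm]
    rfl
  simp_rw [h1]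
  rw [integral_const_mul, integral_fintype_prod_volume_eq_prod
    (fun m (z : ℂ) => Complex.exp (-b * (z * conj z) + z * conj (β m) + γ m * conj z))]
  simp_rw [integral_cexp_complex hb]
  rw [Finset.prod_mul_distrib, Finset.prod_const, Finset.card_univ, Fintype.card_fin,
    ← Complex.exp_sum, Complex.exp_add, mul_left_comm, mul_comm (Complex.exp k)]
  congr 3
  rw [hermProd, Finset.sum_div]
  exact Finset.sum_congr rfl fun m _ => by rw [mul_comm]

/-- A non-integrable function has Bochner integral 0 by convention, whereas the evaluated integral
(π/b)^M is nonzero. -/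
theorem integrable_cexp_hermProd {b : ℝ} (hb : 0 < b) :
    Integrable fun α : Fin M → ℂ => Complex.exp (-b * hermProd α α) := by
  by_contra h
  have h1 := integral_cexp_hermProd (M := M) hb 0 0 0
  have h2 : ∀ α : Fin M → ℂ, hermProd α 0 = 0 ∧ hermProd 0 α = 0 := fun α => by simp [hermProd]
  simp only [h2, add_zero, zero_div, Complex.exp_zero, mul_one] at h1
  rw [integral_undef h] at h1
  have hb' : (b : ℂ) ≠ 0 := by exact_mod_cast hb.ne'
  have : (Real.pi : ℂ) ≠ 0 := by exact_mod_cast Real.pi_ne_zero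
  exact pow_ne_zero M (div_ne_zero this hb') h1.symm

end Gaussian

/-! ### Weak integrals of bounded operator families -/

section WeakIntegral

open MeasureTheory

variable {Ω H : Type*} [MeasurableSpace Ω] [NormedAddCommGroup H] [InnerProductSpace ℂ H]

theorem integrable_mul_inner {μ : Measure Ω} {k : Ω → ℂ} (hk : Integrable k μ) {T : Ω → H →L[ℂ] H}
    {C : ℝ} (hC : ∀ a x, ‖T a x‖ ≤ C * ‖x‖) {x y : H}
    (hT : AEStronglyMeasurable (fun a => ⟪x, T a y⟫_ℂ) μ) :
    Integrable (fun a => k a * ⟪x, T a y⟫_ℂ) μ :=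
  hk.mul_bdd hT (c := ‖x‖ * (C * ‖y‖)) (Filter.Eventually.of_forall fun a =>
    (norm_inner_le_norm _ _).trans (mul_le_mul_of_nonneg_left (hC a y) (norm_nonneg _)))

theorem norm_integral_mul_inner_le {μ : Measure Ω} {k : Ω → ℂ} (hk : Integrable k μ)
    {T : Ω → H →L[ℂ] H} {C : ℝ} (hC : ∀ a x, ‖T a x‖ ≤ C * ‖x‖) (x y : H) :
    ∫ a, ‖k a * ⟪x, T a y⟫_ℂ‖ ∂μ ≤ (C * ∫ a, ‖k a‖ ∂μ) * ‖x‖ * ‖y‖ := by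
  rw [show (C * ∫ a, ‖k a‖ ∂μ) * ‖x‖ * ‖y‖ = ∫ a, ‖k a‖ * (‖x‖ * (C * ‖y‖)) ∂μ by
    rw [integral_mul_const]; ring]
  refine integral_mono_of_nonneg (Filter.Eventually.of_forall fun a => norm_nonneg _)
    (hk.norm.mul_const _) (Filter.Eventually.of_forall fun a => ?_)
  beta_reduce
  rw [norm_mul]
  exact mul_le_mul_of_nonneg_left ((norm_inner_le_norm _ _).trans
    (mul_le_mul_of_nonneg_left (hC a y) (norm_nonneg _))) (norm_nonneg _)

/-- The weak integral `∫ k(a) T(a) da` of a uniformly bounded family of operators, as a bounded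
sesquilinear form. -/
theorem exists_weakIntegral {μ : Measure Ω} {k : Ω → ℂ} (hk : Integrable k μ) {T : Ω → H →L[ℂ] H}
    {C : ℝ} (hC : ∀ a x, ‖T a x‖ ≤ C * ‖x‖)
    (hT : ∀ x y, AEStronglyMeasurable (fun a => ⟪x, T a y⟫_ℂ) μ) :
    ∃ B : H →L⋆[ℂ] H →L[ℂ] ℂ, ∀ x y, B x y = ∫ a, k a * ⟪x, T a y⟫_ℂ ∂μ := by
  have hi := fun x y => integrable_mul_inner hk hC (hT x y)
  refine ⟨LinearMap.mkContinuous₂ (LinearMap.mk₂'ₛₗ (starRingEnd ℂ) (RingHom.id ℂ)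
    (fun x y => ∫ a, k a * ⟪x, T a y⟫_ℂ ∂μ) ?_ ?_ ?_ ?_) (C * ∫ a, ‖k a‖ ∂μ) ?_, ?_⟩
  · intro x x' y
    rw [← integral_add (hi x y) (hi x' y)]
    simp [mul_add]
  · intro c x y
    rw [smul_eq_mul, ← integral_const_mul]
    simp [mul_comm (conj c), mul_assoc]
  · intro x y y'
    rw [← integral_add (hi x y) (hi x y')]
    simp [mul_add]
  · intro c x y
    rw [smul_eq_mul, ← integral_const_mul]
    simp [mul_left_comm]
  · intro x y
    exact (norm_integral_le_integral_norm _).trans (norm_integral_mul_inner_le hk hC x y)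
  · intro x y
    rfl

theorem sesqForm_ext {S : Set H} (hS : Dense (Submodule.span ℂ S : Set H))
    {B B' : H →L⋆[ℂ] H →L[ℂ] ℂ} (h : ∀ x ∈ S, ∀ y ∈ S, B x y = B' x y) : B = B' :=
  ContinuousLinearMap.ext_on hS fun x hx => ContinuousLinearMap.ext_on hS fun y hy => h x hx y hy

end WeakIntegral

/-! ## The displaced parity operators as Fourier transforms of the displacement operators -/

section Identity

open MeasureTheory

variable {M : ℕ}

theorem inner_coherent_displacement_coherent (β γ η : Fin M → ℂ) :
    ⟪displacement β (numberBasis M 0), displacement η (displacement γ (numberBasis M 0))⟫_ℂ =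
      Complex.exp (-(hermProd η η / 2) + hermProd η β - hermProd γ η +
        (hermProd γ β - hermProd β β / 2 - hermProd γ γ / 2)) := by
  rw [inner_displacement_left, displacement_displacement, displacement_displacement,
    smul_smul, inner_smul_right, inner_vacuum_displacement, ← Complex.exp_add, ← Complex.exp_add]
  congr 1
  simp only [hermProd_add_left, hermProd_add_right, hermProd_neg_left, hermProd_neg_right]
  ring

/-- The squared distance of two unit vectors is 2 minus twice the real part of their overlap, and
the overlap of coherent states is an explicit continuous function. -/
theorem continuous_displacement_vacuum :
    Continuous fun α : Fin M → ℂ => displacement α (numberBasis M 0) := by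
  refine continuous_iff_continuousAt.2 fun α₀ => ?_
  rw [ContinuousAt, tendsto_iff_norm_sub_tendsto_zero]
  have h1 : ∀ α : Fin M → ℂ, ‖displacement α (numberBasis M 0) -
      displacement α₀ (numberBasis M 0)‖ = Real.sqrt (2 - 2 * (Complex.exp
        (hermProd α₀ α - hermProd α α / 2 - hermProd α₀ α₀ / 2)).re) := by
    intro α
    rw [← Real.sqrt_sq (norm_nonneg (_ - _)), norm_sub_sq (𝕜 := ℂ), norm_displacement_apply,
      norm_displacement_apply, (numberBasis M).orthonormal.1 0]
    have h2 := inner_coherent_displacement_coherent α α₀ 0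
    rw [displacement_zero] at h2
    rw [h2]
    have h3 : ∀ x : Fin M → ℂ, hermProd x 0 = 0 ∧ hermProd 0 x = 0 := by simp [hermProd]
    simp only [h3, RCLike.re_eq_complex_re, zero_div, neg_zero, sub_zero, zero_add]
    congr 1
    ring
  simp_rw [h1]
  have h2 : Continuous fun α : Fin M → ℂ => Real.sqrt (2 - 2 * (Complex.exp
        (hermProd α₀ α - hermProd α α / 2 - hermProd α₀ α₀ / 2)).re) := by
    have c1 : Continuous fun α : Fin M → ℂ => hermProd α₀ α :=
      continuous_hermProd continuous_const continuous_id
    have c2 : Continuous fun α : Fin M → ℂ => hermProd α α :=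
      continuous_hermProd continuous_id continuous_id
    fun_prop
  have h3 := h2.tendsto α₀
  have h4 : hermProd α₀ α₀ - hermProd α₀ α₀ / 2 - hermProd α₀ α₀ / 2 = 0 := by ring
  rw [h4] at h3
  simpa using h3

/-- The displacement operators are strongly continuous. -/
theorem continuous_displacement_apply (y : FockSpace M) :
    Continuous fun α : Fin M → ℂ => displacement α y := by
  have h1 : ∀ y ∈ coherentSpan M, Continuous fun α : Fin M → ℂ => displacement α y := by
    intro y hy
    refine Submodule.span_induction ?_ ?_ ?_ ?_ hy
    · rintro _ ⟨γ, rfl⟩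
      simp only [displacement_displacement]
      have c1 : Continuous fun α : Fin M → ℂ => hermProd α γ :=
        continuous_hermProd continuous_id continuous_const
      have c2 : Continuous fun α : Fin M → ℂ => hermProd γ α :=
        continuous_hermProd continuous_const continuous_id
      have c3 := continuous_displacement_vacuum.comp
        (continuous_id.add (continuous_const (y := γ)))
      have c4 : Continuous fun α : Fin M → ℂ =>
          Complex.exp ((hermProd α γ - hermProd γ α) / 2) := by fun_prop
      exact c4.smul c3
    · simp only [map_zero]
      exact continuous_const
    · intro x y _ _ hx hy
      simp only [map_add]
      exact hx.add hy
    · intro c x _ hx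
      simp only [map_smul]
      exact hx.const_smul c
  refine continuous_of_uniform_approx_of_continuous fun u hu => ?_
  obtain ⟨ε, hε, hεu⟩ := Metric.mem_uniformity_dist.1 hu
  obtain ⟨z, hz, hzy⟩ := Metric.mem_closure_iff.1 (dense_coherentSpan M y) ε hε
  refine ⟨fun α => displacement α z, h1 z hz, fun α => hεu ?_⟩
  rwa [dist_eq_norm, ← map_sub, norm_displacement_apply, ← dist_eq_norm]

theorem norm_displacedParity_apply_le (α : Fin M → ℂ) (x : FockSpace M) :
    ‖displacedParity α x‖ ≤ ‖parity M‖ * ‖x‖ := by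
  rw [displacedParity_apply, norm_displacement_apply]
  exact (parity M).le_opNorm x

theorem continuous_displacedParity_apply (y : FockSpace M) :
    Continuous fun α : Fin M → ℂ => displacedParity α y := by
  simp only [displacedParity_apply]
  exact (continuous_displacement_apply (parity M y)).comp (continuous_const_smul (2 : ℂ))

/-- Both integrals are Gaussian, with quadratic coefficients 2 + s² on the left and 1 + s²/2 on the
right. The prefactors then agree, and the coefficient of ⟨γ,β⟩ in the exponent is (2 - s²)/(2 + s²)
on both sides. -/
theorem gaussian_displacedParity_coherent {s : ℝ} (hs : s ≠ 0) (β γ : Fin M → ℂ) :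
    ((2 : ℂ) / Real.pi) ^ M * ∫ α : Fin M → ℂ, Complex.exp (-((s ^ 2 : ℝ) : ℂ) * hermProd α α) *
        ⟪displacement β (numberBasis M 0),
          displacedParity α (displacement γ (numberBasis M 0))⟫_ℂ =
      ((1 : ℂ) / Real.pi) ^ M * ∫ u : Fin M → ℂ, Complex.exp (-((1 : ℝ) : ℂ) * hermProd u u) *
        ⟪displacement β (numberBasis M 0),
          displacement ((s : ℂ) • u) (displacement γ (numberBasis M 0))⟫_ℂ := by
  have hs2 : 0 < s ^ 2 := by positivity
  set k := hermProd β β / 2 + hermProd γ γ / 2 with hk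
  have h1 : ∀ α : Fin M → ℂ, Complex.exp (-((s ^ 2 : ℝ) : ℂ) * hermProd α α) *
        ⟪displacement β (numberBasis M 0),
          displacedParity α (displacement γ (numberBasis M 0))⟫_ℂ =
      Complex.exp (-((2 + s ^ 2 : ℝ) : ℂ) * hermProd α α + hermProd α ((2 : ℂ) • β) +
        hermProd ((2 : ℂ) • γ) α + (-hermProd γ β - k)) := by
    intro α
    rw [displacedParity_apply, parity_displacement, parity_vacuum,
      inner_coherent_displacement_coherent, ← Complex.exp_add]
    congr 1
    simp only [hermProd_smul_left, hermProd_smul_right, hermProd_neg_left, hermProd_neg_right,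
      map_ofNat, hk]
    push_cast
    ring
  have h2 : ∀ u : Fin M → ℂ, Complex.exp (-((1 : ℝ) : ℂ) * hermProd u u) *
        ⟪displacement β (numberBasis M 0),
          displacement ((s : ℂ) • u) (displacement γ (numberBasis M 0))⟫_ℂ =
      Complex.exp (-((1 + s ^ 2 / 2 : ℝ) : ℂ) * hermProd u u + hermProd u ((s : ℂ) • β) +
        hermProd (-(s : ℂ) • γ) u + (hermProd γ β - k)) := by
    intro u
    rw [inner_coherent_displacement_coherent, ← Complex.exp_add]
    congr 1
    simp only [hermProd_smul_left, hermProd_smul_right, Complex.conj_ofReal, hk]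
    push_cast
    ring
  simp_rw [h1, h2]
  rw [integral_cexp_hermProd (by positivity), integral_cexp_hermProd (by positivity), ← mul_assoc,
    ← mul_assoc, ← mul_pow, ← mul_pow]
  have hpi : (Real.pi : ℂ) ≠ 0 := by exact_mod_cast Real.pi_ne_zero
  have hb : (2 : ℂ) + (s : ℂ) ^ 2 ≠ 0 := by exact_mod_cast (by positivity : (2 + s ^ 2 : ℝ) ≠ 0)
  have hb' : (1 : ℂ) + (s : ℂ) ^ 2 / 2 ≠ 0 := by
    exact_mod_cast (by positivity : (1 + s ^ 2 / 2 : ℝ) ≠ 0)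
  congr 2
  · push_cast
    field_simp
  · simp only [hermProd_smul_left, hermProd_smul_right, Complex.conj_ofReal, map_ofNat]
    push_cast
    field_simp
    ring

/-- A Gaussian mean of displaced parity operators is a Gaussian mean of displacement operators. -/
theorem gaussian_displacedParity {s : ℝ} (hs : s ≠ 0) (x y : FockSpace M) :
    ((2 : ℂ) / Real.pi) ^ M * ∫ α : Fin M → ℂ, Complex.exp (-((s ^ 2 : ℝ) : ℂ) * hermProd α α) *
        ⟪x, displacedParity α y⟫_ℂ =
      ((1 : ℂ) / Real.pi) ^ M * ∫ u : Fin M → ℂ, Complex.exp (-((1 : ℝ) : ℂ) * hermProd u u) *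
        ⟪x, displacement ((s : ℂ) • u) y⟫_ℂ := by
  -- As bounded sesquilinear forms, the two sides need only be compared on the total set of coherent
  -- states.
  obtain ⟨B, hB⟩ := exists_weakIntegral (μ := volume)
    (integrable_cexp_hermProd (M := M) (b := s ^ 2) (by positivity))
    (T := fun α => displacedParity α) norm_displacedParity_apply_le
    (fun x y => (continuous_const.inner
      (continuous_displacedParity_apply y)).aestronglyMeasurable)
  obtain ⟨B', hB'⟩ := exists_weakIntegral (μ := volume)
    (integrable_cexp_hermProd (M := M) (b := 1) one_pos)
    (T := fun u => displacement ((s : ℂ) • u)) (C := 1)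
    (fun a x => by rw [norm_displacement_apply, one_mul])
    (fun x y => (continuous_const.inner
      ((continuous_displacement_apply y).comp
        (continuous_const_smul (s : ℂ)))).aestronglyMeasurable)
  have h : ((2 : ℂ) / Real.pi) ^ M • B = ((1 : ℂ) / Real.pi) ^ M • B' := by
    refine sesqForm_ext (dense_coherentSpan M) ?_
    rintro _ ⟨β, rfl⟩ _ ⟨γ, rfl⟩
    simp only [smul_apply, smul_eq_mul, hB, hB']
    exact gaussian_displacedParity_coherent hs β γ
  have h2 := congrArg (fun B => B x y) h
  simp only [smul_apply, smul_eq_mul, hB, hB'] at h2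
  exact h2

/-- Parity turns the right factor D(ξ/2) into D(-ξ/2), so D(2α) is conjugated by D(ξ/2) and acquires
only a phase. -/
theorem displacement_half_displacedParity (ξ α : Fin M → ℂ) (x : FockSpace M) :
    displacement ((1 / 2 : ℂ) • ξ) (displacedParity α (displacement ((1 / 2 : ℂ) • ξ) x)) =
      Complex.exp (hermProd ξ α - hermProd α ξ) • displacedParity α x := by
  rw [displacedParity_apply, displacedParity_apply, parity_displacement,
    displacement_displacement, displacement_displacement, smul_smul, ← Complex.exp_add]
  have h : (1 / 2 : ℂ) • ξ + (2 : ℂ) • α + -((1 / 2 : ℂ) • ξ) = (2 : ℂ) • α := by module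
  rw [h]
  congr 2
  simp only [hermProd_add_left, hermProd_add_right, hermProd_neg_left, hermProd_neg_right,
    hermProd_smul_left, hermProd_smul_right, map_ofNat, map_div₀, map_one]
  ring

theorem displacement_half_displacement (ξ η : Fin M → ℂ) (x : FockSpace M) :
    displacement ((1 / 2 : ℂ) • ξ) (displacement η (displacement ((1 / 2 : ℂ) • ξ) x)) =
      displacement (ξ + η) x := by
  rw [displacement_displacement, displacement_displacement, smul_smul,
    ← Complex.exp_add]
  have h : (1 / 2 : ℂ) • ξ + η + (1 / 2 : ℂ) • ξ = ξ + η := by module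
  rw [h]
  convert one_smul ℂ _
  rw [Complex.exp_eq_one_iff]
  refine ⟨0, ?_⟩
  simp only [hermProd_add_left, hermProd_add_right,
      hermProd_smul_left, hermProd_smul_right, map_ofNat, map_div₀, map_one]
  push_cast
  ring

/-- The unshifted identity, applied to D(-ξ/2) x and D(ξ/2) y: this sandwich gives Π(α) a phase but
shifts D(su) to D(ξ + su) without one. -/
theorem gaussian_displacedParity_phase {s : ℝ} (hs : s ≠ 0) (ξ : Fin M → ℂ) (x y : FockSpace M) :
    ((2 : ℂ) / Real.pi) ^ M * ∫ α : Fin M → ℂ, Complex.exp (-((s ^ 2 : ℝ) : ℂ) * hermProd α α) *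
        (Complex.exp (hermProd ξ α - hermProd α ξ) * ⟪x, displacedParity α y⟫_ℂ) =
      ((1 : ℂ) / Real.pi) ^ M * ∫ u : Fin M → ℂ, Complex.exp (-((1 : ℝ) : ℂ) * hermProd u u) *
        ⟪x, displacement (ξ + (s : ℂ) • u) y⟫_ℂ := by
  have h := gaussian_displacedParity hs (displacement (-((1 / 2 : ℂ) • ξ)) x)
    (displacement ((1 / 2 : ℂ) • ξ) y)
  simpa only [inner_displacement_left, neg_neg, displacement_half_displacedParity,
    displacement_half_displacement, inner_smul_right] using h

end Identity

/-! ## Nuclear representation of trace-class operators -/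

section Trace

variable {ι H : Type*} [NormedAddCommGroup H] [InnerProductSpace ℂ H]

theorem hasSum_norm_inner_sq (b : HilbertBasis ι ℂ H) (x : H) :
    HasSum (fun i => ‖⟪b i, x⟫_ℂ‖ ^ 2) (‖x‖ ^ 2) := by
  have h := b.hasSum_inner_mul_inner x x
  have h2 : ∀ i, ⟪x, b i⟫_ℂ * ⟪b i, x⟫_ℂ = ((‖⟪b i, x⟫_ℂ‖ ^ 2 : ℝ) : ℂ) := fun i => by
    rw [← inner_conj_symm, Complex.conj_mul']
    push_cast; rfl
  simp only [h2, inner_self_eq_norm_sq_to_K] at h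
  rw [← Complex.hasSum_ofReal]
  simpa using h

variable [CompleteSpace H]

/-- Cyclicity of the trace: `tr (S S† T) = ∑ᵢ ⟨S bᵢ, T S bᵢ⟩` for a Hilbert–Schmidt `S`. -/
theorem hasSum_inner_hilbertSchmidt (b : HilbertBasis ι ℂ H) {S : H →L[ℂ] H}
    (hS : ContinuousLinearMap.adjoint S = S) (hs : Summable fun i => ‖S (b i)‖ ^ 2)
    (T : H →L[ℂ] H) :
    HasSum (fun i => ⟪b i, S (S (T (b i)))⟫_ℂ) (∑' j, ⟪S (b j), T (S (b j))⟫_ℂ) := by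
  have hS' : ∀ x y, ⟪S x, y⟫_ℂ = ⟪x, S y⟫_ℂ := fun x y => by
    rw [← ContinuousLinearMap.adjoint_inner_right, hS]
  set T' := ContinuousLinearMap.adjoint T with hT'
  -- Summing F over its second index gives ⟨S b_j, T S b_j⟩, over its first gives ⟨b_i, S S T b_i⟩.
  -- Both factors are square summable over pairs because S is Hilbert–Schmidt, so the order of
  -- summation is immaterial.
  set F : ι × ι → ℂ := fun p => ⟪T' (S (b p.1)), b p.2⟫_ℂ * ⟪b p.2, S (b p.1)⟫_ℂ with hF
  have h1 : ∀ y : ι → H, (Summable fun j => ‖y j‖ ^ 2) →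
      Summable fun p : ι × ι => ‖⟪b p.2, y p.1⟫_ℂ‖ ^ 2 := by
    intro y hy
    rw [summable_prod_of_nonneg (fun p => by positivity)]
    refine ⟨fun j => (hasSum_norm_inner_sq b (y j)).summable, ?_⟩
    simpa only [(hasSum_norm_inner_sq b (y _)).tsum_eq] using hy
  have h2 : Summable fun j => ‖T' (S (b j))‖ ^ 2 := by
    refine Summable.of_nonneg_of_le (fun _ => by positivity) (fun j => ?_)
      (hs.mul_left (‖T'‖ ^ 2))
    rw [← mul_pow]
    gcongr
    exact T'.le_opNorm _
  have hFs : Summable F := by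
    refine Summable.of_norm_bounded ((h1 _ h2).add (h1 _ hs)) fun p => ?_
    rw [hF, norm_mul, norm_inner_symm]
    nlinarith [sq_nonneg (‖⟪b p.2, T' (S (b p.1))⟫_ℂ‖ - ‖⟪b p.2, S (b p.1)⟫_ℂ‖),
      sq_nonneg ‖⟪b p.2, T' (S (b p.1))⟫_ℂ‖, sq_nonneg ‖⟪b p.2, S (b p.1)⟫_ℂ‖]
  have h3 : ∀ j, HasSum (fun i => F (j, i)) ⟪S (b j), T (S (b j))⟫_ℂ := fun j => by
    have := b.hasSum_inner_mul_inner (T' (S (b j))) (S (b j))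
    rwa [hT', ContinuousLinearMap.adjoint_inner_left] at this
  have h4 : ∀ i, HasSum (fun j => F (j, i)) ⟪b i, S (S (T (b i)))⟫_ℂ := fun i => by
    have := b.hasSum_inner_mul_inner (S (b i)) (S (T (b i)))
    rw [hS'] at this
    refine this.congr_fun fun j => ?_
    simp only [hF]
    rw [hT', ContinuousLinearMap.adjoint_inner_left, hS', hS', mul_comm]
  have h5 := hFs.hasSum
  rw [(h5.prod_fiberwise h3).tsum_eq]
  have h6 : HasSum (fun p : ι × ι => F p.swap) (∑' p, F p) := (Equiv.prodComm ι ι).hasSum_iff.2 h5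
  exact h6.prod_fiberwise h4

/-- A positive operator with finite trace is a nuclear sum of rank-one operators. -/
theorem exists_hasSum_trace_of_nonneg (b : HilbertBasis ι ℂ H) {P : H →L[ℂ] H} (hP : 0 ≤ P)
    (hs : Summable fun i => (⟪b i, P (b i)⟫_ℂ).re) :
    ∃ x : ι → H, (Summable fun i => ‖x i‖ ^ 2) ∧ ∀ T : H →L[ℂ] H,
      HasSum (fun i => ⟪b i, P (T (b i))⟫_ℂ) (∑' i, ⟪x i, T (x i)⟫_ℂ) := by
  -- The square root is Hilbert–Schmidt, as ‖S b_i‖² = ⟨b_i, P b_i⟩; the nuclear vectors are S b_i.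
  set S := CFC.sqrt P with hS
  have hSS : S * S = P := CFC.sqrt_mul_sqrt_self P hP
  have hSa : ContinuousLinearMap.adjoint S = S :=
    (ContinuousLinearMap.isSelfAdjoint_iff'.1 (IsSelfAdjoint.of_nonneg (CFC.sqrt_nonneg P)))
  have hs' : Summable fun i => ‖S (b i)‖ ^ 2 := by
    refine hs.congr fun i => ?_
    rw [← hSS, mul_apply_eq_comp]
    nth_rw 1 [← hSa]
    rw [ContinuousLinearMap.adjoint_inner_right, inner_self_eq_norm_sq_to_K]
    norm_cast
  refine ⟨fun i => S (b i), hs', fun T => ?_⟩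
  rw [← hSS]
  exact hasSum_inner_hilbertSchmidt b hSa hs' T

/-- From |R| = R⁺ + R⁻ both parts have finite trace; their nuclear sums are joined over `ι ⊕ ι`, the
minus sign of R⁻ being absorbed in y. The vectors do not depend on T, which lets the trace commute
with limits and integrals over families of operators. -/
theorem exists_hasSum_trace (b : HilbertBasis ι ℂ H) {R : H →L[ℂ] H} (hR : IsSelfAdjoint R)
    (hs : IsTraceClass b R) :
    ∃ x y : ι ⊕ ι → H, (Summable fun i => ‖x i‖ * ‖y i‖) ∧ ∀ T : H →L[ℂ] H,
      HasSum (fun i => ⟪x i, T (y i)⟫_ℂ) (trace b (R ∘L T)) := by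
  have hpos : ∀ P : H →L[ℂ] H, 0 ≤ P → ∀ i, 0 ≤ (⟪b i, P (b i)⟫_ℂ).re := fun P hP i => by
    have := ((ContinuousLinearMap.nonneg_iff_isPositive P).1 hP).inner_nonneg_right (b i)
    exact (Complex.nonneg_iff.1 this).1
  have habs : absOp R = R⁺ + R⁻ := (CFC.posPart_add_negPart R hR).symm
  have hsum : ∀ i, (⟪b i, absOp R (b i)⟫_ℂ).re =
      (⟪b i, R⁺ (b i)⟫_ℂ).re + (⟪b i, R⁻ (b i)⟫_ℂ).re := fun i => by
    rw [habs, add_apply, inner_add_right, Complex.add_re]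
  have hp := CFC.posPart_nonneg R
  have hn := CFC.negPart_nonneg R
  obtain ⟨x, hx, hxT⟩ := exists_hasSum_trace_of_nonneg b hp
    (Summable.of_nonneg_of_le (hpos _ hp) (fun i => by
      rw [hsum]; linarith [hpos _ hn i]) hs)
  obtain ⟨y, hy, hyT⟩ := exists_hasSum_trace_of_nonneg b hn
    (Summable.of_nonneg_of_le (hpos _ hn) (fun i => by
      rw [hsum]; linarith [hpos _ hp i]) hs)
  have hsT : ∀ (z : ι → H), (Summable fun i => ‖z i‖ ^ 2) → ∀ T : H →L[ℂ] H,
      Summable fun i => ⟪z i, T (z i)⟫_ℂ := fun z hz T => by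
    refine Summable.of_norm_bounded (hz.mul_left ‖T‖) fun i => ?_
    refine (norm_inner_le_norm _ _).trans ?_
    nlinarith [T.le_opNorm (z i), norm_nonneg (z i)]
  refine ⟨Sum.elim x y, Sum.elim x (-y), ?_, fun T => ?_⟩
  · refine Summable.sum _ ?_ ?_
    · simpa [sq, Function.comp_def] using hx
    · simpa [sq, Function.comp_def] using hy
  · have h1 : trace b (R ∘L T) = ∑' i, ⟪x i, T (x i)⟫_ℂ + -∑' i, ⟪y i, T (y i)⟫_ℂ := by
      refine ((hxT T).add (hyT T).neg).congr_fun (fun i => ?_) |>.tsum_eq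
      rw [← sub_eq_add_neg, ← inner_sub_right, ← sub_apply, CFC.posPart_sub_negPart R hR]
      rfl
    rw [h1]
    refine HasSum.sum ?_ ?_
    · simpa [Function.comp_def] using (hsT x hx T).hasSum
    · simpa [Function.comp_def] using (hsT y hy T).hasSum.neg

end Trace

/-! ## Bochner's theorem for the characteristic function -/

section Bochner

open MeasureTheory Filter Topology

/-! ### Limits and integrals of nuclear sums -/

section Family

variable {ι H X : Type*} [NormedAddCommGroup H] [InnerProductSpace ℂ H] {T : X → H →L[ℂ] H}
  {C : ℝ} {w : X → ℂ} {x y : ι → H}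

theorem norm_inner_apply_le (hC : ∀ a z, ‖T a z‖ ≤ C * ‖z‖) (i : ι) (a : X) :
    ‖⟪x i, T a (y i)⟫_ℂ‖ ≤ C * (‖x i‖ * ‖y i‖) := by
  refine (norm_inner_le_norm _ _).trans ?_
  nlinarith [mul_le_mul_of_nonneg_left (hC a (y i)) (norm_nonneg (x i))]

theorem norm_le_of_hasSum_inner (hxy : Summable fun i => ‖x i‖ * ‖y i‖)
    (hC : ∀ a z, ‖T a z‖ ≤ C * ‖z‖) (hw : ∀ a, HasSum (fun i => ⟪x i, T a (y i)⟫_ℂ) (w a))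
    (a : X) : ‖w a‖ ≤ C * ∑' i, ‖x i‖ * ‖y i‖ := by
  rw [← (hw a).tsum_eq, ← tsum_mul_left]
  exact tsum_of_norm_bounded (hxy.mul_left C).hasSum fun i => norm_inner_apply_le hC i a

theorem continuous_of_hasSum_inner [TopologicalSpace X] (hxy : Summable fun i => ‖x i‖ * ‖y i‖)
    (hC : ∀ a z, ‖T a z‖ ≤ C * ‖z‖) (hw : ∀ a, HasSum (fun i => ⟪x i, T a (y i)⟫_ℂ) (w a))
    (hT : ∀ z, Continuous fun a => T a z) : Continuous w := by
  have : w = fun a => ∑' i, ⟪x i, T a (y i)⟫_ℂ := funext fun a => (hw a).tsum_eq.symm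
  rw [this]
  exact continuous_tsum (fun i => continuous_const.inner (hT (y i))) (hxy.mul_left C)
    fun i a => norm_inner_apply_le hC i a

theorem hasSum_integral_mul_inner [Countable ι] [MeasurableSpace X] {μ : Measure X} {k : X → ℂ}
    (hk : Integrable k μ) (hxy : Summable fun i => ‖x i‖ * ‖y i‖)
    (hC : ∀ a z, ‖T a z‖ ≤ C * ‖z‖) (hw : ∀ a, HasSum (fun i => ⟪x i, T a (y i)⟫_ℂ) (w a))
    (hT : ∀ z z', AEStronglyMeasurable (fun a => ⟪z, T a z'⟫_ℂ) μ) :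
    HasSum (fun i => ∫ a, k a * ⟪x i, T a (y i)⟫_ℂ ∂μ) (∫ a, k a * w a ∂μ) := by
  have h1 : ∀ a, k a * w a = ∑' i, k a * ⟪x i, T a (y i)⟫_ℂ := fun a => by
    rw [tsum_mul_left, (hw a).tsum_eq]
  simp_rw [h1]
  refine hasSum_integral_of_summable_integral_norm
    (fun i => integrable_mul_inner hk hC (hT _ _)) ?_
  refine Summable.of_nonneg_of_le (fun i => integral_nonneg fun a => norm_nonneg _)
    (fun i => norm_integral_mul_inner_le hk hC (x i) (y i)) ?_
  simpa only [mul_assoc] using hxy.mul_left (C * ∫ a, ‖k a‖ ∂μ)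

end Family

variable {M : ℕ}

theorem norm_cexp_hermProd_sub (ξ α : Fin M → ℂ) :
    ‖Complex.exp (hermProd ξ α - hermProd α ξ)‖ = 1 := by
  rw [Complex.norm_exp, ← conj_hermProd ξ α]
  simp

theorem norm_cexp_neg_hermProd_le {b : ℝ} (hb : 0 ≤ b) (α : Fin M → ℂ) :
    ‖Complex.exp (-(b : ℂ) * hermProd α α)‖ ≤ 1 := by
  rw [Complex.norm_exp, hermProd_self, ← Complex.ofReal_neg, ← Complex.ofReal_mul,
    Complex.ofReal_re]
  refine Real.exp_le_one_iff.2 ?_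
  have : 0 ≤ ∑ m, ‖α m‖ ^ 2 := Finset.sum_nonneg fun _ _ => by positivity
  nlinarith

theorem continuous_cexp_hermProd_sub (ξ : Fin M → ℂ) :
    Continuous fun α : Fin M → ℂ => Complex.exp (hermProd ξ α - hermProd α ξ) := by
  have c1 : Continuous fun α : Fin M → ℂ => hermProd α ξ :=
    continuous_hermProd continuous_id continuous_const
  have c2 : Continuous fun α : Fin M → ℂ => hermProd ξ α :=
    continuous_hermProd continuous_const continuous_id
  fun_prop

theorem continuous_cexp_neg_hermProd (b : ℂ) :
    Continuous fun α : Fin M → ℂ => Complex.exp (-b * hermProd α α) := by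
  have c1 : Continuous fun α : Fin M → ℂ => hermProd α α :=
    continuous_hermProd continuous_id continuous_id
  fun_prop

variable {R : FockSpace M →L[ℂ] FockSpace M}

theorem continuous_trace_displacement (hR : IsSelfAdjoint R)
    (hs : IsTraceClass (numberBasis M) R) :
    Continuous fun α => trace (numberBasis M) (R ∘L displacement α) := by
  obtain ⟨x, y, hxy, hT⟩ := exists_hasSum_trace (numberBasis M) hR hs
  exact continuous_of_hasSum_inner (C := 1) hxy
    (fun a x => by rw [norm_displacement_apply, one_mul]) (fun a => hT _)
    continuous_displacement_apply

theorem exists_norm_trace_displacement_le (hR : IsSelfAdjoint R)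
    (hs : IsTraceClass (numberBasis M) R) :
    ∃ K : ℝ, ∀ α, ‖trace (numberBasis M) (R ∘L displacement α)‖ ≤ K := by
  obtain ⟨x, y, hxy, hT⟩ := exists_hasSum_trace (numberBasis M) hR hs
  exact ⟨_, norm_le_of_hasSum_inner (C := 1) (T := fun α => displacement α) hxy
    (fun a x => by rw [norm_displacement_apply, one_mul]) (fun a => hT _)⟩

theorem continuous_trace_displacedParity (hR : IsSelfAdjoint R)
    (hs : IsTraceClass (numberBasis M) R) :
    Continuous fun α => trace (numberBasis M) (R ∘L displacedParity α) := by
  obtain ⟨x, y, hxy, hT⟩ := exists_hasSum_trace (numberBasis M) hR hs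
  exact continuous_of_hasSum_inner hxy norm_displacedParity_apply_le (fun a => hT _)
    continuous_displacedParity_apply

theorem continuous_inner_displacedParity (x y : FockSpace M) :
    Continuous fun α : Fin M → ℂ => ⟪x, displacedParity α y⟫_ℂ :=
  continuous_const.inner (continuous_displacedParity_apply y)

theorem continuous_inner_displacement_add (ξ : Fin M → ℂ) (s : ℂ) (x y : FockSpace M) :
    Continuous fun u : Fin M → ℂ => ⟪x, displacement (ξ + s • u) y⟫_ℂ := by
  have h : Continuous fun u : Fin M → ℂ => ξ + s • u := by fun_prop
  exact continuous_const.inner ((continuous_displacement_apply y).comp h)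

theorem integrable_gaussian_mul_phase {b : ℝ} (hb : 0 < b) (ξ : Fin M → ℂ) :
    Integrable fun α : Fin M → ℂ => Complex.exp (-(b : ℂ) * hermProd α α) *
      Complex.exp (hermProd ξ α - hermProd α ξ) :=
  (integrable_cexp_hermProd hb).mul_bdd (c := 1)
    (continuous_cexp_hermProd_sub ξ).aestronglyMeasurable
    (Eventually.of_forall fun α => (norm_cexp_hermProd_sub ξ α).le)

theorem hasSum_gaussian_displacedParity {ι : Type*} [Countable ι] {x y : ι → FockSpace M}
    (hxy : Summable fun i => ‖x i‖ * ‖y i‖) {w : (Fin M → ℂ) → ℂ}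
    (hw : ∀ α, HasSum (fun i => ⟪x i, displacedParity α (y i)⟫_ℂ) (w α)) {b : ℝ} (hb : 0 < b)
    (ξ : Fin M → ℂ) :
    HasSum (fun i => ∫ α : Fin M → ℂ, Complex.exp (-(b : ℂ) * hermProd α α) *
      (Complex.exp (hermProd ξ α - hermProd α ξ) * ⟪x i, displacedParity α (y i)⟫_ℂ))
      (∫ α : Fin M → ℂ, Complex.exp (-(b : ℂ) * hermProd α α) *
        (Complex.exp (hermProd ξ α - hermProd α ξ) * w α)) := by
  simp only [← mul_assoc]
  exact hasSum_integral_mul_inner (T := displacedParity) (integrable_gaussian_mul_phase hb ξ) hxy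
    norm_displacedParity_apply_le hw
    fun x y => (continuous_inner_displacedParity x y).aestronglyMeasurable

theorem hasSum_gaussian_displacement {ι : Type*} [Countable ι] {x y : ι → FockSpace M}
    (hxy : Summable fun i => ‖x i‖ * ‖y i‖) {χ : (Fin M → ℂ) → ℂ}
    (hχ : ∀ α, HasSum (fun i => ⟪x i, displacement α (y i)⟫_ℂ) (χ α)) {b : ℝ} (hb : 0 < b)
    (ξ : Fin M → ℂ) (s : ℂ) :
    HasSum (fun i => ∫ u : Fin M → ℂ, Complex.exp (-(b : ℂ) * hermProd u u) *
      ⟪x i, displacement (ξ + s • u) (y i)⟫_ℂ)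
      (∫ u : Fin M → ℂ, Complex.exp (-(b : ℂ) * hermProd u u) * χ (ξ + s • u)) :=
  hasSum_integral_mul_inner (T := fun u => displacement (ξ + s • u)) (C := 1)
    (integrable_cexp_hermProd hb) hxy (fun a x => by rw [norm_displacement_apply, one_mul])
    (fun u => hχ (ξ + s • u))
    fun x y => (continuous_inner_displacement_add ξ s x y).aestronglyMeasurable

/-- Both sides are sums over the same nuclear vectors of R, and the summands agree by
`gaussian_displacedParity_phase`. -/
theorem gaussian_trace_displacedParity (hR : IsSelfAdjoint R)
    (hs : IsTraceClass (numberBasis M) R) {s : ℝ} (h0 : s ≠ 0) (ξ : Fin M → ℂ) :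
    ((2 : ℂ) / Real.pi) ^ M * ∫ α : Fin M → ℂ, Complex.exp (-((s ^ 2 : ℝ) : ℂ) * hermProd α α) *
        (Complex.exp (hermProd ξ α - hermProd α ξ) *
          trace (numberBasis M) (R ∘L displacedParity α)) =
      ((1 : ℂ) / Real.pi) ^ M * ∫ u : Fin M → ℂ, Complex.exp (-((1 : ℝ) : ℂ) * hermProd u u) *
        trace (numberBasis M) (R ∘L displacement (ξ + (s : ℂ) • u)) := by
  obtain ⟨x, y, hxy, hT⟩ := exists_hasSum_trace (numberBasis M) hR hs
  have hs2 : 0 < s ^ 2 := by positivity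
  have h1 := (hasSum_gaussian_displacedParity hxy (fun α => hT (displacedParity α)) hs2
    ξ).mul_left (((2 : ℂ) / Real.pi) ^ M)
  have h2 := (hasSum_gaussian_displacement hxy (fun α => hT (displacement α)) one_pos
    ξ s).mul_left (((1 : ℂ) / Real.pi) ^ M)
  simp only [gaussian_displacedParity_phase h0 ξ] at h1
  exact h1.unique h2

/-- If the Wigner function is integrable, its symplectic Fourier transform is the characteristic
function. -/
theorem trace_displacement_eq_integral (hR : IsSelfAdjoint R)
    (hs : IsTraceClass (numberBasis M) R)
    (hint : Integrable fun α => trace (numberBasis M) (R ∘L displacedParity α))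
    (ξ : Fin M → ℂ) :
    trace (numberBasis M) (R ∘L displacement ξ) =
      ((2 : ℂ) / Real.pi) ^ M * ∫ α : Fin M → ℂ, Complex.exp (hermProd ξ α - hermProd α ξ) *
        trace (numberBasis M) (R ∘L displacedParity α) := by
  set w := fun α => trace (numberBasis M) (R ∘L displacedParity α) with hw
  set χ := fun α => trace (numberBasis M) (R ∘L displacement α) with hχ
  have hwc : Continuous w := continuous_trace_displacedParity hR hs
  have hχc : Continuous χ := continuous_trace_displacement hR hs
  obtain ⟨K, hK⟩ := exists_norm_trace_displacement_le hR hs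
  -- The integrability of `w` enters here, as the dominating function. The limit is taken over s ≠
  -- 0, where the regularised identity holds.
  have hlhs : Tendsto (fun s : ℝ => ∫ α : Fin M → ℂ,
      Complex.exp (-((s ^ 2 : ℝ) : ℂ) * hermProd α α) *
        (Complex.exp (hermProd ξ α - hermProd α ξ) * w α)) (𝓝[≠] 0)
      (𝓝 (∫ α : Fin M → ℂ, Complex.exp (hermProd ξ α - hermProd α ξ) * w α)) := by
    refine tendsto_integral_filter_of_dominated_convergence (fun α => ‖w α‖)
      (Eventually.of_forall fun s => ?_) (Eventually.of_forall fun s => ?_) hint.norm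
      (Eventually.of_forall fun α => ?_)
    · exact ((continuous_cexp_neg_hermProd _).mul
        ((continuous_cexp_hermProd_sub ξ).mul hwc)).aestronglyMeasurable
    · refine Eventually.of_forall fun α => ?_
      rw [norm_mul, norm_mul, norm_cexp_hermProd_sub, one_mul]
      exact mul_le_of_le_one_left (norm_nonneg _) (norm_cexp_neg_hermProd_le (sq_nonneg s) α)
    · have hc : Continuous fun s : ℝ => Complex.exp (-((s ^ 2 : ℝ) : ℂ) * hermProd α α) *
        (Complex.exp (hermProd ξ α - hermProd α ξ) * w α) := by fun_prop
      have := (hc.tendsto 0).mono_left (nhdsWithin_le_nhds (s := {0}ᶜ))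
      simpa using this
  -- Here the Gaussian keeps a fixed width and χ is bounded and continuous, so the average of χ(ξ +
  -- su) tends to that of the constant χ(ξ).
  have hrhs : Tendsto (fun s : ℝ => ∫ u : Fin M → ℂ,
      Complex.exp (-((1 : ℝ) : ℂ) * hermProd u u) * χ (ξ + (s : ℂ) • u)) (𝓝[≠] 0)
      (𝓝 (∫ u : Fin M → ℂ, Complex.exp (-((1 : ℝ) : ℂ) * hermProd u u) * χ ξ)) := by
    refine tendsto_integral_filter_of_dominated_convergence
      (fun u => ‖Complex.exp (-((1 : ℝ) : ℂ) * hermProd u u)‖ * K)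
      (Eventually.of_forall fun s => ?_) (Eventually.of_forall fun s => ?_)
      ((integrable_cexp_hermProd (M := M) (b := 1) one_pos).norm.mul_const K)
      (Eventually.of_forall fun u => ?_)
    · exact ((continuous_cexp_neg_hermProd _).mul (hχc.comp (continuous_const.add
        (continuous_const_smul (s : ℂ))))).aestronglyMeasurable
    · refine Eventually.of_forall fun u => ?_
      rw [norm_mul]
      exact mul_le_mul_of_nonneg_left (hK _) (norm_nonneg _)
    · have hc : Continuous fun s : ℝ =>
          Complex.exp (-((1 : ℝ) : ℂ) * hermProd u u) * χ (ξ + (s : ℂ) • u) :=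
        continuous_const.mul (hχc.comp (by fun_prop))
      have := (hc.tendsto 0).mono_left (nhdsWithin_le_nhds (s := {0}ᶜ))
      simpa using this
  have h1 := (hlhs.const_mul (((2 : ℂ) / Real.pi) ^ M)).congr' (by
    filter_upwards [self_mem_nhdsWithin] with s h0
    exact gaussian_trace_displacedParity hR hs h0 ξ)
  have h2 := tendsto_nhds_unique h1 (hrhs.const_mul (((1 : ℂ) / Real.pi) ^ M))
  have h3 := integral_cexp_hermProd (M := M) (b := 1) one_pos 0 0 0
  have h4 : ∀ α : Fin M → ℂ, hermProd α 0 = 0 ∧ hermProd 0 α = 0 := fun α => by simp [hermProd]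
  simp only [h4, add_zero, zero_div, Complex.exp_zero, mul_one] at h3
  have hpi : (Real.pi : ℂ) ≠ 0 := by exact_mod_cast Real.pi_ne_zero
  rw [integral_mul_const, h3, ← mul_assoc, ← mul_pow] at h2
  rw [h2]
  have h5 : (1 : ℂ) / Real.pi * (Real.pi / ((1 : ℝ) : ℂ)) = 1 := by
    push_cast
    field_simp
  rw [h5, one_pow, one_mul]

end Bochner

/-! ## Trace norm of a mean of rank-one matrices -/

section TraceNorm

open MeasureTheory

/-- Singular value decomposition, with left singular vectors satisfying Bessel's inequality. -/
theorem exists_singularVectors {E : Type*} [NormedAddCommGroup E] [InnerProductSpace ℂ E]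
    [FiniteDimensional ℂ E] {N : ℕ} (hN : Module.finrank ℂ E = N) (T : E →ₗ[ℂ] E) :
    ∃ (e : OrthonormalBasis (Fin N) ℂ E) (u : Fin N → E),
      (∀ i, ⟪u i, T (e i)⟫_ℂ = T.singularValues i) ∧
        ∀ x, ∑ i, ‖⟪u i, x⟫_ℂ‖ ^ 2 ≤ ‖x‖ ^ 2 := by
  classical
  set hT := T.isSymmetric_adjoint_comp_self
  set e := hT.eigenvectorBasis hN with he
  set σ : Fin N → ℝ := fun i => T.singularValues i with hσ
  have h1 : ∀ i j, ⟪T (e i), T (e j)⟫_ℂ = if i = j then ((σ j ^ 2 : ℝ) : ℂ) else 0 := by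
    intro i j
    rw [← LinearMap.adjoint_inner_right, ← LinearMap.comp_apply, he,
      hT.apply_eigenvectorBasis, inner_smul_right, ← he,
      orthonormal_iff_ite.1 e.orthonormal i j, hσ, T.sq_singularValues_fin hN j]
    split_ifs <;> simp
  -- Where σ_i = 0 the convention 0⁻¹ = 0 makes u_i vanish. The remaining u_i are orthonormal, so
  -- Bessel's inequality holds without completing them to a basis.
  set u : Fin N → E := fun i => ((σ i)⁻¹ : ℂ) • T (e i) with hu
  refine ⟨e, u, fun i => ?_, fun x => ?_⟩
  · rw [hu]
    simp only [inner_smul_left, h1, if_true]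
    change conj ((σ i)⁻¹ : ℂ) * ((σ i ^ 2 : ℝ) : ℂ) = (σ i : ℂ)
    by_cases h0 : σ i = 0
    · simp [h0]
    · have : (σ i : ℂ) ≠ 0 := by exact_mod_cast h0
      simp only [map_inv₀, Complex.conj_ofReal]
      push_cast
      field_simp
  · have ho : Orthonormal ℂ fun i : {i // σ i ≠ 0} => u i := by
      rw [orthonormal_iff_ite]
      rintro ⟨i, hi⟩ ⟨j, hj⟩
      have hi' : (σ i : ℂ) ≠ 0 := by exact_mod_cast hi
      simp only [hu, inner_smul_left, inner_smul_right, h1, Subtype.mk.injEq, map_inv₀,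
        Complex.conj_ofReal]
      split_ifs with h
      · subst h
        push_cast
        field_simp
      · simp
    have h2 := ho.sum_inner_products_le (s := Finset.univ) x
    refine le_trans (le_of_eq ?_) h2
    rw [← Finset.sum_subtype (Finset.univ.filter fun i => σ i ≠ 0) (by simp)
      (fun i => ‖⟪u i, x⟫_ℂ‖ ^ 2), Finset.sum_filter]
    refine Finset.sum_congr rfl fun i _ => ?_
    split_ifs with h
    · rfl
    · simp [hu, not_not.1 h]

/-- With singular vectors u_i, e_i the trace norm is ∑ ⟨u_i, A e_i⟩ = ∫ f ∑ ⟨u_i, v⟩⟨v, e_i⟩. The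
inner sum is at most ‖v‖² ≤ 1 in modulus, by Bessel for the u_i and Parseval for the e_i. -/
theorem matrixTraceNorm_le {Ω : Type*} [MeasurableSpace Ω] {μ : Measure Ω} {N : ℕ}
    {A : Matrix (Fin N) (Fin N) ℂ} {f : Ω → ℂ} (hf : Integrable f μ) {v : Ω → Fin N → ℂ}
    (hv : ∀ n, AEStronglyMeasurable (fun a => v a n) μ) (hv1 : ∀ a, ∑ n, ‖v a n‖ ^ 2 ≤ 1)
    (hA : ∀ n n', A n n' = ∫ a, f a * (v a n * conj (v a n')) ∂μ) :
    matrixTraceNorm A ≤ ∫ a, ‖f a‖ ∂μ := by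
  obtain ⟨e, u, hu, hux⟩ := exists_singularVectors (finrank_euclideanSpace_fin (𝕜 := ℂ) (n := N))
    (Matrix.toEuclideanLin A)
  set V : Ω → EuclideanSpace ℂ (Fin N) := fun a => WithLp.toLp 2 (v a) with hV
  have hVn : ∀ a, ‖V a‖ ^ 2 ≤ 1 := fun a => by
    rw [EuclideanSpace.norm_sq_eq]
    exact hv1 a
  have hvn : ∀ a n, ‖v a n‖ ≤ 1 := fun a n => by
    have h1 := (Finset.single_le_sum (f := fun n => ‖v a n‖ ^ 2) (fun i _ => by positivity)
      (Finset.mem_univ n)).trans (hv1 a)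
    exact (sq_le_one_iff₀ (norm_nonneg _)).1 h1
  have hint : ∀ n n', Integrable (fun a => f a * (v a n * conj (v a n'))) μ := fun n n' => by
    refine hf.mul_bdd (c := 1) ((hv n).mul ((Complex.continuous_conj).comp_aestronglyMeasurable
      (hv n'))) (Filter.Eventually.of_forall fun a => ?_)
    rw [norm_mul, RCLike.norm_conj]
    exact mul_le_one₀ (hvn a n) (norm_nonneg _) (hvn a n')
  have hx : ∀ x y : EuclideanSpace ℂ (Fin N), ∀ a, f a * (⟪x, V a⟫_ℂ * ⟪V a, y⟫_ℂ) =
      ∑ n, ∑ n', (conj (x n) * y n') * (f a * (v a n * conj (v a n'))) := by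
    intro x y a
    simp only [PiLp.inner_apply, RCLike.inner_apply, hV]
    rw [Finset.sum_mul_sum, Finset.mul_sum]
    refine Finset.sum_congr rfl fun n _ => ?_
    rw [Finset.mul_sum]
    refine Finset.sum_congr rfl fun n' _ => ?_
    ring
  have hxi : ∀ x y : EuclideanSpace ℂ (Fin N),
      Integrable (fun a => f a * (⟪x, V a⟫_ℂ * ⟪V a, y⟫_ℂ)) μ := by
    intro x y
    simp only [hx]
    exact integrable_finsetSum _ fun n _ => integrable_finsetSum _ fun n' _ =>
      (hint n n').const_mul _
  have hAx : ∀ x y : EuclideanSpace ℂ (Fin N), ⟪x, Matrix.toEuclideanLin A y⟫_ℂ =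
      ∫ a, f a * (⟪x, V a⟫_ℂ * ⟪V a, y⟫_ℂ) ∂μ := by
    intro x y
    simp only [hx]
    rw [integral_finsetSum _ fun n _ => integrable_finsetSum _ fun n' _ =>
      (hint n n').const_mul _]
    simp only [PiLp.inner_apply, RCLike.inner_apply, Matrix.toLpLin_apply,
      Matrix.mulVec, dotProduct]
    refine Finset.sum_congr rfl fun n _ => ?_
    rw [integral_finsetSum _ fun n' _ => (hint n n').const_mul _, Finset.sum_mul]
    refine Finset.sum_congr rfl fun n' _ => ?_
    rw [integral_const_mul, ← hA]
    ring
  have hsum : ((matrixTraceNorm A : ℝ) : ℂ) =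
      ∫ a, f a * ∑ i, ⟪u i, V a⟫_ℂ * ⟪V a, e i⟫_ℂ ∂μ := by
    simp only [Finset.mul_sum]
    rw [integral_finsetSum _ fun i _ => hxi (u i) (e i)]
    simp only [← hAx, hu, matrixTraceNorm]
    push_cast
    rfl
  have hbound : ∀ a, ‖∑ i, ⟪u i, V a⟫_ℂ * ⟪V a, e i⟫_ℂ‖ ≤ 1 := by
    intro a
    have h1 : ∑ i, ‖⟪e i, V a⟫_ℂ‖ ^ 2 = ‖V a‖ ^ 2 := e.sum_sq_norm_inner_right (V a)
    calc ‖∑ i, ⟪u i, V a⟫_ℂ * ⟪V a, e i⟫_ℂ‖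
        ≤ ∑ i, (‖⟪u i, V a⟫_ℂ‖ ^ 2 + ‖⟪e i, V a⟫_ℂ‖ ^ 2) / 2 := by
          refine norm_sum_le_of_le _ fun i _ => ?_
          rw [norm_mul, norm_inner_symm (V a)]
          nlinarith [sq_nonneg (‖⟪u i, V a⟫_ℂ‖ - ‖⟪e i, V a⟫_ℂ‖)]
      _ ≤ 1 := by
          rw [← Finset.sum_div, Finset.sum_add_distrib, h1]
          linarith [hux (V a), hVn a]
  have h0 : 0 ≤ matrixTraceNorm A :=
    Finset.sum_nonneg fun i _ => LinearMap.singularValues_nonneg _ _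
  calc matrixTraceNorm A = ‖((matrixTraceNorm A : ℝ) : ℂ)‖ := by
        rw [Complex.norm_real, Real.norm_of_nonneg h0]
    _ ≤ ∫ a, ‖f a‖ ∂μ := by
        rw [hsum]
        refine norm_integral_le_of_norm_le hf.norm (Filter.Eventually.of_forall fun a => ?_)
        rw [norm_mul]
        exact mul_le_of_le_one_right (norm_nonneg _) (hbound a)

end TraceNorm

/-! ### The bound for the characteristic matrix -/

theorem matrixTraceNorm_characteristicMatrix_le {M N : ℕ} {R : FockSpace M →L[ℂ] FockSpace M}
    (hR : IsSelfAdjoint R) (hs : IsTraceClass (numberBasis M) R)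
    (hint : MeasureTheory.Integrable fun α => trace (numberBasis M) (R ∘L displacedParity α))
    (ξ : Fin N → Fin M → ℂ) :
    matrixTraceNorm (characteristicMatrix R ξ) ≤
      ∫ α, ‖((2 : ℂ) / Real.pi) ^ M * trace (numberBasis M) (R ∘L displacedParity α)‖ := by
  -- The factor 1/N of the matrix is split evenly between v and its conjugate, making v(α) a unit
  -- vector for N > 0; for N = 0 its squared norm is 0, so only the bound by 1 is claimed.
  set c : ℂ := (((Real.sqrt N)⁻¹ : ℝ) : ℂ) with hc
  have hcc : c * c = 1 / N := by
    rw [hc, ← Complex.ofReal_mul, ← mul_inv, Real.mul_self_sqrt (Nat.cast_nonneg N)]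
    push_cast
    rw [one_div]
  refine matrixTraceNorm_le (hint.const_mul _)
    (v := fun α n => c * Complex.exp (hermProd (ξ n) α - hermProd α (ξ n)))
    (fun n => (continuous_const.mul (continuous_cexp_hermProd_sub (ξ n))).aestronglyMeasurable)
    (fun α => ?_) (fun n n' => ?_)
  · have h1 : ‖c‖ ^ 2 = (N : ℝ)⁻¹ := by
      rw [hc, Complex.norm_real, Real.norm_of_nonneg (by positivity), inv_pow,
        Real.sq_sqrt (Nat.cast_nonneg N)]
    simp only [norm_mul, norm_cexp_hermProd_sub, mul_one, h1, Finset.sum_const, Finset.card_univ,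
      Fintype.card_fin, nsmul_eq_mul]
    exact mul_inv_le_one
  · rw [characteristicMatrix, Matrix.of_apply, trace_displacement_eq_integral hR hs hint,
      ← MeasureTheory.integral_const_mul, ← MeasureTheory.integral_const_mul]
    congr 1
    funext α
    -- The exponent is additive in ξ and purely imaginary, so the phase of a difference is a
    -- rank-one kernel.
    have h2 : Complex.exp (hermProd (ξ n - ξ n') α - hermProd α (ξ n - ξ n')) =
        Complex.exp (hermProd (ξ n) α - hermProd α (ξ n)) *
          conj (Complex.exp (hermProd (ξ n') α - hermProd α (ξ n'))) := by
      rw [← Complex.exp_conj, ← Complex.exp_add]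
      congr 1
      simp only [sub_eq_add_neg (ξ n), hermProd_add_left, hermProd_add_right, hermProd_neg_left,
        hermProd_neg_right, map_sub, conj_hermProd]
      ring
    rw [h2, ← hcc, map_mul, hc, Complex.conj_ofReal]
    ring

end BosonicModes


theorem mainTheorem1 (M N : ℕ)
    (R : BosonicModes.FockSpace M →L[ℂ] BosonicModes.FockSpace M)
    (hR : IsSelfAdjoint R)
    (hRtc : BosonicModes.IsTraceClass (BosonicModes.numberBasis M) R)
    (ξ : Fin N → Fin M → ℂ) :
    ENNReal.ofReal (BosonicModes.matrixTraceNorm (BosonicModes.characteristicMatrix R ξ)) ≤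
      ENNReal.ofReal ((2 / Real.pi) ^ M) *
        ∫⁻ α : Fin M → ℂ,
          ‖BosonicModes.trace (BosonicModes.numberBasis M)
            (R ∘L BosonicModes.displacedParity α)‖ₑ := by
  have hpos : 0 < (2 / Real.pi) ^ M := by positivity
  -- A divergent integral makes the right-hand side infinite because the prefactor is positive;
  -- otherwise continuity of `w` supplies the measurability needed for integrability.
  by_cases htop : ∫⁻ α : Fin M → ℂ, ‖BosonicModes.trace (BosonicModes.numberBasis M)
      (R ∘L BosonicModes.displacedParity α)‖ₑ = ⊤
  · rw [htop, ENNReal.mul_top (ENNReal.ofReal_pos.2 hpos).ne']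
    exact le_top
  · have hint : MeasureTheory.Integrable fun α : Fin M → ℂ =>
        BosonicModes.trace (BosonicModes.numberBasis M) (R ∘L BosonicModes.displacedParity α) :=
      ⟨(BosonicModes.continuous_trace_displacedParity hR hRtc).aestronglyMeasurable,
        lt_top_iff_ne_top.2 htop⟩
    refine (ENNReal.ofReal_le_ofReal
      (BosonicModes.matrixTraceNorm_characteristicMatrix_le hR hRtc hint ξ)).trans (le_of_eq ?_)
    have h2 : ‖((2 : ℂ) / Real.pi) ^ M‖ = (2 / Real.pi) ^ M := by
      rw [norm_pow, norm_div, Complex.norm_real, Real.norm_of_nonneg Real.pi_pos.le]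
      norm_num
    simp only [norm_mul, h2]
    rw [MeasureTheory.integral_const_mul, ENNReal.ofReal_mul hpos.le,
      MeasureTheory.ofReal_integral_norm_eq_lintegral_enorm hint]
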